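/- All graphs are finite and simple, $d(u)$ is the degree of the vertex $u$, $\mathcal N(H,G)$ is the number of (not necessarily induced) subgraphs of $G$ isomorphic to $H$, and $T(n,3)$ is the Turán graph, i.e. the complete $3$-partite graph on $n$ vertices with every part of order $\lfloor n/3\rfloor$ or $\lceil n/3\rceil$. The generalized book graph $B_t(p,q)$ consists of an edge $uv$, $t$ vertices joined to both $u$ and $v$, $p$ further vertices joined only to $u$, and $q$ further vertices joined only to $v$; the double star is $S_{p,q}=B_0(p,q)$. Let $\mathrm{ex}(n,H,K_4)$ be the largest value of $\mathcal N(H,G)$, and $\mathrm{ex}_Q(n,K_4)$ the largest value of $Q(G)$, over all $K_4$-free graphs $G$ on $n$ vertices. Let $A_0$ be the set of the following indices, where $r,s$ range over the non-negative integers: the vertex sums $M_1(G)=\sum_{u\in V(G)}d(u)^2$, $F(G)=\sum_{u\in V(G)}d(u)^3$, $R^{(0)}_r(G)=\sum_{u\in V(G)}d(u)^r$ (with $0^0=1$), and the sums $\sum_{uv\in E(G)}f(d(u),d(v))$ over edges with $f(x,y)$ equal to $xy$ ($M_2$), $(x-1)(y-1)$ ($RM_2$), $(x+y)^2$ ($HM_1$),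 $(xy)^2$ ($HM_2$), $(x^2+y^2)^2$ ($HF$), $(x+y-2)^2$ ($EM_1$), $3x+3y-4$ (first K Banhatti index), $(x+y-2)(x+y)$ (second K Banhatti index), $(x+y)^r$ ($\chi_r$), $(xy)^r$ ($R_r$), $x^ry^s+x^sy^r$ ($M_{r,s}$). Let $A_0'\subset A_0$ be the set of those indices whose defining polynomial, as written above, has degree at most $2$ in each variable; that is, all of them except $F$, $HF$, and those $R^{(0)}_r,\chi_r,R_r$ with $r>2$ and $M_{r,s}$ with $\max(r,s)>2$. **Theorem.** For every $n\ge 0$: (i) $\mathrm{ex}(n,B_1(1,1),K_4)=\mathcal N(B_1(1,1),T(n,3))$; (ii) $\mathrm{ex}(n,S_{1,2},K_4)=\mathcal N(S_{1,2},T(n,3))$; (iii) for every index $Q\in A_0'$, $\mathrm{ex}_Q(n,K_4)=Q(T(n,3))$. -/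

import Mathlib

/-- The vertices of the generalized book graph `B_t(p,q)`: the two rootlet vertices `u`, `v`,
the `t` pages (joined to both rootlets), `p` leaves at `u` and `q` leaves at `v`. -/
inductive BookVertex (t p q : ℕ) : Type
  | u : BookVertex t p q
  | v : BookVertex t p q
  | page (i : Fin t) : BookVertex t p q
  | leafU (i : Fin p) : BookVertex t p q
  | leafV (i : Fin q) : BookVertex t p q

/-- The edges of `B_t(p,q)`, each listed in one orientation. -/
inductive BookEdge (t p q : ℕ) : BookVertex t p q → BookVertex t p q → Prop
  | root : BookEdge t p q .u .v
  | pageU (i : Fin t) : BookEdge t p q .u (.page i)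
  | pageV (i : Fin t) : BookEdge t p q .v (.page i)
  | leafU (i : Fin p) : BookEdge t p q .u (.leafU i)
  | leafV (i : Fin q) : BookEdge t p q .v (.leafV i)

/-- The generalized book graph `B_t(p,q)`. -/
def bookGraph (t p q : ℕ) : SimpleGraph (BookVertex t p q) :=
  SimpleGraph.fromRel (BookEdge t p q)

/-- The double star `S_{p,q} = B_0(p,q)`. -/
abbrev doubleStar (p q : ℕ) : SimpleGraph (BookVertex 0 p q) := bookGraph 0 p q

/-- A polynomial degree-based index: a sum over vertices of `p(d(u))`, or a sum over edges `uv` of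
`p(d(u), d(v))`, where `p` takes the same value at `(x, y)` and `(y, x)`. -/
inductive DegreeIndex : Type
  | overVertices (p : Polynomial ℤ) : DegreeIndex
  | overEdges (p : MvPolynomial (Fin 2) ℤ)
      (symm : ∀ x y : ℤ, p.eval ![x, y] = p.eval ![y, x]) : DegreeIndex

namespace DegreeIndex

open Classical in
/-- The value `Q(G)` of the index `Q` at the finite graph `G`. -/
noncomputable def value {V : Type*} [Fintype V] (G : SimpleGraph V) : DegreeIndex → ℤ
  | overVertices p => ∑ w : V, p.eval (G.degree w : ℤ)
  | overEdges p symm => ∑ e ∈ G.edgeFinset,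
      Sym2.lift ⟨fun x y => p.eval ![(G.degree x : ℤ), (G.degree y : ℤ)],
        fun x y => symm (G.degree x) (G.degree y)⟩ e

/-- The polynomial of the index has degree at most `k` in each variable. -/
def DegreeLE (k : ℕ) : DegreeIndex → Prop
  | overVertices p => p.natDegree ≤ k
  | overEdges p _ => ∀ i : Fin 2, p.degreeOf i ≤ k

section Vertices
open Polynomial

/-- First Zagreb index `M_1`. -/
noncomputable def firstZagreb : DegreeIndex := overVertices (X ^ 2)

/-- Forgotten topological index `F`. -/
noncomputable def forgotten : DegreeIndex := overVertices (X ^ 3)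

/-- General zeroth order Randić index `R^{(0)}_r`. -/
noncomputable def zerothRandic (r : ℕ) : DegreeIndex := overVertices (X ^ r)

end Vertices

section Edges
open MvPolynomial

/-- Second Zagreb index `M_2`. -/
noncomputable def secondZagreb : DegreeIndex :=
  overEdges (X 0 * X 1) (by intro x y; simp; ring)

/-- Reduced second Zagreb index `RM_2`. -/
noncomputable def reducedSecondZagreb : DegreeIndex :=
  overEdges ((X 0 - 1) * (X 1 - 1)) (by intro x y; simp; ring)

/-- First hyper Zagreb index `HM_1`. -/
noncomputable def firstHyperZagreb : DegreeIndex :=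
  overEdges ((X 0 + X 1) ^ 2) (by intro x y; simp; ring)

/-- Second hyper Zagreb index `HM_2`. -/
noncomputable def secondHyperZagreb : DegreeIndex :=
  overEdges ((X 0 * X 1) ^ 2) (by intro x y; simp; ring)

/-- Hyper `F`-index `HF`. -/
noncomputable def hyperF : DegreeIndex :=
  overEdges ((X 0 ^ 2 + X 1 ^ 2) ^ 2) (by intro x y; simp; ring)

/-- First reformulated Zagreb index `EM_1`. -/
noncomputable def firstReformulatedZagreb : DegreeIndex :=
  overEdges ((X 0 + X 1 - 2) ^ 2) (by intro x y; simp; ring)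

/-- First K Banhatti index `B_1`. -/
noncomputable def firstBanhatti : DegreeIndex :=
  overEdges (3 * X 0 + 3 * X 1 - 4) (by intro x y; simp; ring)

/-- Second K Banhatti index `B_2`. -/
noncomputable def secondBanhatti : DegreeIndex :=
  overEdges ((X 0 + X 1 - 2) * (X 0 + X 1)) (by intro x y; simp; ring)

/-- General sum-connectivity index `χ_r`. -/
noncomputable def sumConnectivity (r : ℕ) : DegreeIndex :=
  overEdges ((X 0 + X 1) ^ r) (by intro x y; simp [add_comm])

/-- General Randić index `R_r`. -/
noncomputable def generalRandic (r : ℕ) : DegreeIndex :=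
  overEdges ((X 0 * X 1) ^ r) (by intro x y; simp [mul_comm])

/-- Generalized Zagreb index `M_{r,s}`. -/
noncomputable def generalizedZagreb (r s : ℕ) : DegreeIndex :=
  overEdges (X 0 ^ r * X 1 ^ s + X 0 ^ s * X 1 ^ r) (by intro x y; simp; ring)

end Edges

/-- The set `A_0` of all indices listed above, for all non-negative integers `r`, `s`. -/
inductive A0 : DegreeIndex → Prop
  | firstZagreb : A0 firstZagreb
  | forgotten : A0 forgotten
  | secondZagreb : A0 secondZagreb
  | reducedSecondZagreb : A0 reducedSecondZagreb
  | firstHyperZagreb : A0 firstHyperZagreb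
  | secondHyperZagreb : A0 secondHyperZagreb
  | hyperF : A0 hyperF
  | firstReformulatedZagreb : A0 firstReformulatedZagreb
  | firstBanhatti : A0 firstBanhatti
  | secondBanhatti : A0 secondBanhatti
  | sumConnectivity (r : ℕ) : A0 (sumConnectivity r)
  | zerothRandic (r : ℕ) : A0 (zerothRandic r)
  | generalRandic (r : ℕ) : A0 (generalRandic r)
  | generalizedZagreb (r s : ℕ) : A0 (generalizedZagreb r s)

/-- The set `A_0'` of the indices in `A_0` whose polynomial has degree at most 2 in each
variable. -/
def A0' (Q : DegreeIndex) : Prop := A0 Q ∧ Q.DegreeLE 2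

end DegreeIndex

open Finset

/-! Two classical facts carry the argument. The weighted Turán inequality of Motzkin and Straus
(`three_mul_arcSum_le`) bounds the sum of `w u * w v` over ordered adjacent pairs by two thirds of
the square of the total weight. Erdős's majorization (`exists_deg_le`) bounds vertex sums of
monotone functions of the degree by those of a complete tripartite graph; for the powers needed,
moving vertices from a largest to a smallest part then leads to balanced parts (`sum_shiftPow_le`).

For (iii), write the degrees at the ends of an edge as `a + 1`, `b + 1`. Every edge polynomial in
`A0'` becomes a combination, with non-negative coefficients, of symmetrised monomials `a ^ i * b ^
j` with `i, j ≤ 2`, so it suffices to treat each monomial (`mono_le_turanGraph`). The constant is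
Turán's theorem, and `a`, `a ^ 2` reduce to vertex power sums of order at most three. The monomials
`a * b`, `a ^ 2 * b ^ 2` are Motzkin–Straus with shifted degrees or their squares as weights, and `a
^ 2 * b` follows from the others by an AM-GM estimate (`mono_two_one_le`). Motzkin–Straus is not
tight when `3 ∤ n`. However, if `G` is not the Turán graph, the power sums of orders one and two are
strictly smaller, hence smaller by at least 1, and this pays for the rounding.

For (ii), labelled double stars are an edge sum in the degrees and the codegree. The codegree is at
least `d(u) + d(v) - n`, with equality in the Turán graph, so the sum is bounded by an edge
polynomial; in degrees shifted by 3 it has non-negative coefficients and the same method applies.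
Orders below 12 need finite checks.

For (i), a copy is a triangle with two leaves. The number of ways to attach the leaves, summed over
the three root edges of one triangle, is at most a constant that every triangle of the Turán graph
attains (`three_mul_bookSum_le`), and the Turán graph also has the most triangles
(`exists_triSum_le`). -/

namespace TuranIndex

/-! ### Weighted Turán inequality, triangle count and degree majorization. -/

section Weights

variable {V : Type*}

open Classical in
/-- The sum of `w u * w v` over all ordered pairs of adjacent vertices of `s`. -/
noncomputable def pairSum (G : SimpleGraph V) (w : V → ℤ) (s : Finset V) : ℤ :=
  ∑ u ∈ s, ∑ v ∈ s, if G.Adj u v then w u * w v else 0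

-- Let `v₀` have the heaviest neighbourhood `N` in `s`, and let `R = s \ N`. By maximality, the
-- pairs starting in `R` contribute at most the weight of `N` times that of `R`. The pairs from `N`
-- to `R` are the reverses of pairs starting in `R`, so the same bound covers them.
open Classical in
lemma exists_pairSum_le (G : SimpleGraph V) {w : V → ℤ} (hw : ∀ v, 0 ≤ w v) {s : Finset V}
    (hs : s.Nonempty) :
    ∃ v₀ ∈ s, pairSum G w s ≤ pairSum G w (s.filter (G.Adj v₀)) +
      2 * (∑ v ∈ s.filter (G.Adj v₀), w v) * (∑ v ∈ s, w v - ∑ v ∈ s.filter (G.Adj v₀), w v) := by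
  obtain ⟨v₀, hv₀, hmax⟩ := s.exists_max_image (fun u => ∑ v ∈ s, if G.Adj u v then w v else 0) hs
  refine ⟨v₀, hv₀, ?_⟩
  set N := s.filter (G.Adj v₀) with hN
  set R := s.filter (fun v => ¬ G.Adj v₀ v) with hR
  have hsplit : ∀ f : V → ℤ, ∑ v ∈ s, f v = ∑ v ∈ N, f v + ∑ v ∈ R, f v := fun f =>
    (sum_filter_add_sum_filter_not s (G.Adj v₀) f).symm
  have hW : ∑ v ∈ s, (if G.Adj v₀ v then w v else 0) = ∑ v ∈ N, w v := by rw [hN, sum_filter]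
  set K : V → V → ℤ := fun u v => if G.Adj u v then w u * w v else 0 with hK
  have hsymm : ∑ u ∈ N, ∑ v ∈ R, K u v = ∑ u ∈ R, ∑ v ∈ N, K u v := by
    rw [sum_comm]
    refine sum_congr rfl fun u _ => sum_congr rfl fun v _ => ?_
    simp only [hK, G.adj_comm u v, mul_comm (w u)]
  have hpos : 0 ≤ ∑ u ∈ R, ∑ v ∈ R, K u v :=
    sum_nonneg fun u _ => sum_nonneg fun v _ => by
      simp only [hK]; split_ifs; exacts [mul_nonneg (hw _) (hw _), le_rfl]
  have hdeg : ∑ u ∈ R, ∑ v ∈ s, K u v ≤ (∑ v ∈ N, w v) * ∑ u ∈ R, w u := by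
    rw [mul_sum]
    refine sum_le_sum fun u hu => ?_
    have : ∑ v ∈ s, K u v = w u * ∑ v ∈ s, if G.Adj u v then w v else 0 := by
      rw [mul_sum]; refine sum_congr rfl fun v _ => ?_
      simp [hK]
    rw [this, mul_comm, ← hW]
    exact mul_le_mul_of_nonneg_right (hmax u (mem_filter.1 hu).1) (hw u)
  have e1 : pairSum G w s = ∑ u ∈ N, ∑ v ∈ N, K u v + ∑ u ∈ N, ∑ v ∈ R, K u v
      + ∑ u ∈ R, ∑ v ∈ s, K u v := by
    unfold pairSum
    rw [hsplit]
    congr 1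
    rw [← sum_add_distrib]
    exact sum_congr rfl fun u _ => hsplit _
  have e2 : ∑ u ∈ R, ∑ v ∈ s, K u v = ∑ u ∈ R, ∑ v ∈ N, K u v + ∑ u ∈ R, ∑ v ∈ R, K u v := by
    rw [← sum_add_distrib]
    exact sum_congr rfl fun u _ => hsplit _
  have e3 : pairSum G w N = ∑ u ∈ N, ∑ v ∈ N, K u v := rfl
  rw [e1, e3, hsplit w]
  linarith

lemma pairSum_eq_zero {G : SimpleGraph V} (w : V → ℤ) {s : Finset V}
    (hs : ∀ u ∈ s, ∀ v ∈ s, ¬ G.Adj u v) : pairSum G w s = 0 := by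
  classical
  exact sum_eq_zero fun u hu => sum_eq_zero fun v hv => if_neg (hs u hu v hv)

lemma not_four_adj {G : SimpleGraph V} (hG : G.CliqueFree 4) {a b c d : V} (hab : G.Adj a b)
    (hac : G.Adj a c) (had : G.Adj a d) (hbc : G.Adj b c) (hbd : G.Adj b d) : ¬ G.Adj c d := by
  classical
  intro hcd
  refine hG {a, b, c, d} ⟨?_, ?_⟩
  · simp [SimpleGraph.isClique_insert, hab, hac, had, hbc, hbd, hcd]
  · simp [hab.ne, hac.ne, had.ne, hbc.ne, hbd.ne, hcd.ne]

variable [Fintype V]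

open Classical in
/-- The sum of `f u v` over all ordered pairs of adjacent vertices `u`, `v`. -/
noncomputable def arcSum (G : SimpleGraph V) (f : V → V → ℤ) : ℤ :=
  ∑ u, ∑ v, if G.Adj u v then f u v else 0

open Classical in
/-- The degree of a vertex. -/
noncomputable def deg (G : SimpleGraph V) (v : V) : ℕ := #{u | G.Adj v u}

open Classical in
/-- The number of common neighbours of two vertices. -/
noncomputable def codeg (G : SimpleGraph V) (u v : V) : ℕ := #{a | G.Adj u a ∧ G.Adj v a}

open Classical in
/-- A weighted form of Mantel's theorem in the neighbourhood of a vertex of a `K₄`-free graph. -/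
lemma exists_pairSum_neighbors_le {G : SimpleGraph V} (hG : G.CliqueFree 4) {w : V → ℤ}
    (hw : ∀ v, 0 ≤ w v) (v₀ : V) :
    ∃ t : Finset V, t ⊆ ({u | G.Adj v₀ u} : Finset V) ∧
      pairSum G w ({u | G.Adj v₀ u} : Finset V) ≤ 2 * (∑ v ∈ t, w v) *
        (∑ v ∈ ({u | G.Adj v₀ u} : Finset V), w v - ∑ v ∈ t, w v) := by
  rcases ({u | G.Adj v₀ u} : Finset V).eq_empty_or_nonempty with h | h
  · refine ⟨∅, by simp, ?_⟩
    rw [h]; simp [pairSum]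
  · obtain ⟨v₁, h₁, hle⟩ := exists_pairSum_le G hw h
    refine ⟨_, filter_subset (G.Adj v₁) _, hle.trans ?_⟩
    rw [pairSum_eq_zero w, zero_add]
    intro u hu v hv
    simp only [mem_filter, mem_univ, true_and] at hu hv h₁
    exact not_four_adj hG h₁ hu.1 hv.1 hu.2 hv.2

/-- A weighted form of Turán's theorem (Motzkin–Straus) for `K₄`-free graphs. -/
theorem three_mul_arcSum_le {G : SimpleGraph V} (hG : G.CliqueFree 4) {w : V → ℤ}
    (hw : ∀ v, 0 ≤ w v) : 3 * arcSum G (fun u v => w u * w v) ≤ 2 * (∑ v, w v) ^ 2 := by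
  classical
  have h0 : arcSum G (fun u v => w u * w v) = pairSum G w univ := rfl
  rw [h0]
  rcases (univ : Finset V).eq_empty_or_nonempty with h | h
  · rw [h]; simp [pairSum]
  · obtain ⟨v₀, -, hle⟩ := exists_pairSum_le G hw h
    obtain ⟨t, -, ht⟩ := exists_pairSum_neighbors_le hG hw v₀
    set W := ∑ v ∈ ({u | G.Adj v₀ u} : Finset V), w v
    set S := ∑ v, w v
    set X := ∑ v ∈ t, w v
    -- The bound `2X(W - X) + 2W(S - W)` is largest at `X = W / 2`, `W = 2S / 3`, which is three
    -- parts of equal weight.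
    nlinarith [sq_nonneg (W - 2 * X), sq_nonneg (3 * W - 2 * S)]

open Classical in
/-- The sum of `f u v x` over all ordered triples of vertices of a triangle. -/
noncomputable def triSum (G : SimpleGraph V) (f : V → V → V → ℤ) : ℤ :=
  ∑ u, ∑ v, ∑ x, if G.Adj u v ∧ G.Adj u x ∧ G.Adj v x then f u v x else 0

/-- A `K₄`-free graph has at most as many triangles as some complete tripartite graph. -/
theorem exists_triSum_le {G : SimpleGraph V} (hG : G.CliqueFree 4) :
    ∃ a b c : ℕ, a + b + c = Fintype.card V ∧ triSum G (fun _ _ _ => 1) ≤ 6 * (a * b * c : ℕ) := by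
  classical
  rcases (univ : Finset V).eq_empty_or_nonempty with h | h
  · refine ⟨0, 0, Fintype.card V, by simp, ?_⟩
    simp [triSum, h]
  · set t : V → ℤ := fun u => pairSum G (fun _ => 1) ({v | G.Adj u v} : Finset V) with ht
    obtain ⟨v₀, -, hmax⟩ := exists_max_image univ t h
    obtain ⟨s, hs, hle⟩ := exists_pairSum_neighbors_le hG (w := fun _ => 1) (by simp) v₀
    set N := ({v | G.Adj v₀ v} : Finset V) with hN
    have hNc := card_le_univ N
    have hsc := card_le_card hs
    -- The parts are the non-neighbours of the vertex `v₀` in most triangles, and the two sides of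
    -- the Mantel bound inside its neighbourhood.
    refine ⟨Fintype.card V - #N, #s, #N - #s, by omega, ?_⟩
    set T : V → V → V → ℤ := fun u v x => if G.Adj u v ∧ G.Adj u x ∧ G.Adj v x then 1 else 0
      with hT
    set r : V → ℤ := fun u => if G.Adj v₀ u then 0 else 1 with hr
    have hsum : ∀ u, t u = ∑ v, ∑ x, T u v x := by
      intro u
      simp only [ht, pairSum, hT, sum_filter, mul_one]
      refine sum_congr rfl fun v _ => ?_
      by_cases huv : G.Adj u v
      · simp only [huv, if_true, true_and]
        refine sum_congr rfl fun x _ => ?_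
        by_cases hux : G.Adj u x <;> simp [hux]
      · simp [huv]
    -- A triangle inside the neighbourhood of `v₀` would give a `K₄`, so every triangle has a vertex
    -- marked by `r`.
    have hpt : ∀ u v x, T u v x ≤ r u * T u v x + r v * T u v x + r x * T u v x := by
      intro u v x
      simp only [hT, hr]
      by_cases h1 : G.Adj u v ∧ G.Adj u x ∧ G.Adj v x
      · have := not_four_adj hG (a := v₀) (b := u) (c := v) (d := x)
        simp only [h1, and_self, if_true]
        split_ifs <;> simp_all
      · simp [h1]
    have hA : ∑ u, ∑ v, ∑ x, r u * T u v x ≤ (Fintype.card V - #N : ℤ) * t v₀ := by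
      have : ∀ u, ∑ v, ∑ x, r u * T u v x = r u * t u := by
        intro u; rw [hsum, mul_sum]; exact sum_congr rfl fun v _ => (mul_sum _ _ _).symm
      simp only [this]
      have hr0 : ∀ u, 0 ≤ r u := fun u => by simp only [hr]; split_ifs <;> simp
      calc ∑ u, r u * t u ≤ ∑ u, r u * t v₀ :=
            sum_le_sum fun u _ => mul_le_mul_of_nonneg_left (hmax u (mem_univ u)) (hr0 u)
        _ = (Fintype.card V - #N : ℤ) * t v₀ := by
            rw [← sum_mul]; congr 1
            have : ∀ u, r u = 1 - if G.Adj v₀ u then 1 else 0 := fun u => by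
              simp only [hr]; split_ifs <;> simp
            simp [this, hN]
    have hB : ∑ u, ∑ v, ∑ x, r v * T u v x = ∑ u, ∑ v, ∑ x, r u * T u v x := by
      rw [sum_comm]
      refine sum_congr rfl fun u _ => sum_congr rfl fun v _ => sum_congr rfl fun x _ => ?_
      simp only [hT, G.adj_comm v u]
      congr 2
      simp only [eq_iff_iff]; tauto
    have hC : ∑ u, ∑ v, ∑ x, r x * T u v x = ∑ u, ∑ v, ∑ x, r v * T u v x := by
      refine sum_congr rfl fun u _ => ?_
      rw [sum_comm]
      refine sum_congr rfl fun v _ => sum_congr rfl fun x _ => ?_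
      simp only [hT, G.adj_comm x v]
      congr 2
      simp only [eq_iff_iff]; tauto
    have htot : triSum G (fun _ _ _ => 1) ≤ 3 * ((Fintype.card V - #N : ℤ) * t v₀) := by
      calc triSum G (fun _ _ _ => 1) = ∑ u, ∑ v, ∑ x, T u v x := rfl
        _ ≤ ∑ u, ∑ v, ∑ x, (r u * T u v x + r v * T u v x + r x * T u v x) :=
            sum_le_sum fun u _ => sum_le_sum fun v _ => sum_le_sum fun x _ => hpt u v x
        _ ≤ _ := by
            simp only [sum_add_distrib]
            rw [hC, hB]; linarith
    have ht0 : t v₀ ≤ 2 * (#s : ℤ) * (#N - #s) := by simpa using hle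
    rw [Nat.cast_mul, Nat.cast_mul, Nat.cast_sub hNc, Nat.cast_sub hsc]
    have : (0 : ℤ) ≤ Fintype.card V - #N := by have : (#N : ℤ) ≤ Fintype.card V := by exact_mod_cast hNc
                                               linarith
    nlinarith [mul_le_mul_of_nonneg_left ht0 this]

/-- Erdős's theorem: the degrees of a `K₄`-free graph are dominated by the degrees of a complete
tripartite graph, with parts of order `a`, `b`, `c`. -/
theorem exists_deg_le {G : SimpleGraph V} (hG : G.CliqueFree 4) :
    ∃ (a b c : ℕ) (D : V → ℕ), a + b + c = Fintype.card V ∧ (∀ v, deg G v ≤ D v) ∧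
      (∀ v, D v = Fintype.card V - a ∨ D v = Fintype.card V - b ∨ D v = Fintype.card V - c) ∧
      ∀ φ : ℕ → ℤ, ∑ v, φ (D v) = a * φ (Fintype.card V - a) + b * φ (Fintype.card V - b)
        + c * φ (Fintype.card V - c) := by
  classical
  -- `N` will be the neighbourhood of a vertex of maximum degree and `C` the neighbourhood in `N` of
  -- a vertex of maximum degree within `N`. The parts are `Nᶜ`, `N \ C` and `C`; the last is
  -- independent since `G` is `K₄`-free.
  suffices h : ∃ N C : Finset V, C ⊆ N ∧ (∀ v ∉ N, deg G v ≤ #N) ∧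
      (∀ v ∈ N, v ∉ C → deg G v ≤ Fintype.card V - #(N \ C)) ∧
      (∀ v ∈ C, deg G v ≤ Fintype.card V - #C) by
    obtain ⟨N, C, hCN, h1, h2, h3⟩ := h
    have hN := card_le_univ N
    have hC := card_le_card hCN
    have hd := card_sdiff_of_subset hCN
    have hcc := card_compl N
    refine ⟨#Nᶜ, #(N \ C), #C, fun v => if v ∈ N then (if v ∈ C then Fintype.card V - #C else
      Fintype.card V - #(N \ C)) else Fintype.card V - #Nᶜ, by omega, ?_, ?_, ?_⟩
    · intro v
      dsimp only
      split_ifs with hv hv'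
      · exact h3 v hv'
      · exact h2 v hv hv'
      · have := h1 v hv; omega
    · intro v
      dsimp only
      split_ifs <;> simp
    · intro φ
      rw [← sum_add_sum_compl N, ← sum_sdiff hCN]
      have e1 : ∀ v ∈ N \ C, φ (if v ∈ N then (if v ∈ C then Fintype.card V - #C else
          Fintype.card V - #(N \ C)) else Fintype.card V - #Nᶜ) = φ (Fintype.card V - #(N \ C)) := by
        intro v hv; simp only [mem_sdiff] at hv; simp [hv.1, hv.2]
      have e2 : ∀ v ∈ C, φ (if v ∈ N then (if v ∈ C then Fintype.card V - #C else
          Fintype.card V - #(N \ C)) else Fintype.card V - #Nᶜ) = φ (Fintype.card V - #C) := by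
        intro v hv; simp [hCN hv, hv]
      have e3 : ∀ v ∈ Nᶜ, φ (if v ∈ N then (if v ∈ C then Fintype.card V - #C else
          Fintype.card V - #(N \ C)) else Fintype.card V - #Nᶜ) = φ (Fintype.card V - #Nᶜ) := by
        intro v hv; simp only [mem_compl] at hv; simp [hv]
      rw [sum_congr rfl e1, sum_congr rfl e2, sum_congr rfl e3]
      simp only [sum_const, nsmul_eq_mul]
      ring
  rcases (univ : Finset V).eq_empty_or_nonempty with h | h
  · refine ⟨∅, ∅, by simp, fun v => ?_, by simp, by simp⟩
    exact absurd (mem_univ v) (by rw [h]; simp)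
  obtain ⟨v₀, -, hmax⟩ := exists_max_image univ (deg G) h
  set N := ({u | G.Adj v₀ u} : Finset V) with hN
  have key : ∀ v : V, ∀ X : Finset V, (∀ u ∈ X, ¬ G.Adj v u) → deg G v ≤ Fintype.card V - #X := by
    intro v X hX
    rw [← card_compl]
    refine card_le_card fun u hu => ?_
    simp only [mem_filter, mem_univ, true_and] at hu
    exact mem_compl.2 fun hu' => hX u hu' hu
  rcases N.eq_empty_or_nonempty with hNe | hNe
  · exact ⟨N, ∅, by simp, fun v _ => hmax v (mem_univ v), by simp [hNe], by simp⟩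
  obtain ⟨v₁, h₁, hmax₁⟩ := exists_max_image N (fun v => #(N.filter (G.Adj v))) hNe
  refine ⟨N, N.filter (G.Adj v₁), filter_subset _ _, fun v _ => hmax v (mem_univ v), ?_, ?_⟩
  · intro v hv _
    have hc := card_sdiff_of_subset (filter_subset (G.Adj v₁) N)
    have hle : deg G v ≤ #(N.filter (G.Adj v)) + #Nᶜ := by
      refine le_trans (card_le_card fun u hu => ?_) (card_union_le _ _)
      simp only [mem_filter, mem_univ, true_and, mem_union, mem_compl] at hu ⊢
      tauto
    have := hmax₁ v hv
    have h3 := card_le_card (filter_subset (G.Adj v₁) N)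
    have h4 := card_le_univ N
    rw [card_compl] at hle
    omega
  · intro v hv
    refine key v _ fun u hu => ?_
    simp only [hN, mem_filter, mem_univ, true_and] at hv hu h₁
    exact not_four_adj hG h₁ hv.1 hu.1 hv.2 hu.2

end Weights

/-! ### Balancing the parts of a complete tripartite graph. -/

section Smoothing

/-- The sum of squares is kept because it is the induction measure of `le_balanced`; the bounds on
`x` and `z` transport unbalancedness to the sorted triple in `lt_balanced`. -/
lemma exists_sorted {F : ℕ → ℕ → ℕ → ℤ} (h12 : ∀ a b c, F a b c = F b a c)
    (h23 : ∀ a b c, F a b c = F a c b) (a b c : ℕ) :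
    ∃ x y z : ℕ, x ≤ y ∧ y ≤ z ∧ x + y + z = a + b + c ∧ x ≤ a ∧ x ≤ b ∧ x ≤ c ∧ a ≤ z ∧ b ≤ z ∧
      c ≤ z ∧ x * x + y * y + z * z = a * a + b * b + c * c ∧ F a b c = F x y z := by
  rcases le_total a b with h1 | h1 <;> rcases le_total b c with h2 | h2 <;>
    rcases le_total a c with h3 | h3
  · exact ⟨a, b, c, by omega, by omega, by omega, by omega, by omega, by omega, by omega, by omega,
      by omega, by ring, rfl⟩
  · exact ⟨a, b, c, by omega, by omega, by omega, by omega, by omega, by omega, by omega, by omega,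
      by omega, by ring, rfl⟩
  · exact ⟨a, c, b, by omega, by omega, by omega, by omega, by omega, by omega, by omega, by omega,
      by omega, by ring, h23 _ _ _⟩
  · exact ⟨c, a, b, by omega, by omega, by omega, by omega, by omega, by omega, by omega, by omega,
      by omega, by ring, by rw [h23, h12]⟩
  · exact ⟨b, a, c, by omega, by omega, by omega, by omega, by omega, by omega, by omega, by omega,
      by omega, by ring, h12 _ _ _⟩
  · exact ⟨b, c, a, by omega, by omega, by omega, by omega, by omega, by omega, by omega, by omega,
      by omega, by ring, by rw [h12, h23]⟩
  · exact ⟨c, b, a, by omega, by omega, by omega, by omega, by omega, by omega, by omega, by omega,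
      by omega, by ring, by rw [h12, h23, h12]⟩
  · exact ⟨c, b, a, by omega, by omega, by omega, by omega, by omega, by omega, by omega, by omega,
      by omega, by ring, by rw [h12, h23, h12]⟩

/-- If moving one vertex from a largest to a smallest part never decreases `F`, then `F` is
maximal at the balanced triple. -/
theorem le_balanced {n : ℕ} {F : ℕ → ℕ → ℕ → ℤ} (h12 : ∀ a b c, F a b c = F b a c)
    (h23 : ∀ a b c, F a b c = F a c b)
    (step : ∀ a b c, a ≤ b → a + 2 ≤ c → a + b + c = n → F a b c ≤ F (a + 1) b (c - 1))
    (a b c : ℕ) (h : a + b + c = n) : F a b c ≤ F (n / 3) ((n + 1) / 3) ((n + 2) / 3) := by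
  induction hm : a * a + b * b + c * c using Nat.strong_induction_on generalizing a b c with
  | _ m ih =>
    obtain ⟨x, y, z, hxy, hyz, hs, -, -, -, -, -, -, hq, hF⟩ := exists_sorted h12 h23 a b c
    rw [hF]
    by_cases hxz : x + 2 ≤ z
    · refine (step x y z hxy hxz (by omega)).trans (ih _ ?_ _ _ _ (by omega) rfl)
      obtain ⟨w, rfl⟩ := Nat.exists_eq_add_of_le hxz
      rw [← hm, ← hq]
      have : x + 2 + w - 1 = x + 1 + w := by omega
      rw [this]; nlinarith
    · have h1 : x = n / 3 := by omega
      have h2 : y = (n + 1) / 3 := by omega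
      have h3 : z = (n + 2) / 3 := by omega
      rw [h1, h2, h3]

/-- The parts `a`, `b`, `c` are as equal as possible. -/
def Balanced (n a b c : ℕ) : Prop :=
  (n / 3 ≤ a ∧ n / 3 ≤ b ∧ n / 3 ≤ c) ∧ a ≤ (n + 2) / 3 ∧ b ≤ (n + 2) / 3 ∧ c ≤ (n + 2) / 3

theorem lt_balanced {n : ℕ} {F : ℕ → ℕ → ℕ → ℤ} (h12 : ∀ a b c, F a b c = F b a c)
    (h23 : ∀ a b c, F a b c = F a c b)
    (step : ∀ a b c, a ≤ b → a + 2 ≤ c → a + b + c = n → F a b c < F (a + 1) b (c - 1))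
    (a b c : ℕ) (h : a + b + c = n) (hne : ¬ Balanced n a b c) :
    F a b c < F (n / 3) ((n + 1) / 3) ((n + 2) / 3) := by
  obtain ⟨x, y, z, hxy, hyz, hs, ha', hb', hc', ha, hb, hc, hq, hF⟩ := exists_sorted h12 h23 a b c
  rw [hF]
  have hxz : x + 2 ≤ z := by unfold Balanced at hne; omega
  exact (step x y z hxy hxz (by omega)).trans_le
    (le_balanced h12 h23 (fun a b c h1 h2 h3 => (step a b c h1 h2 h3).le) _ _ _ (by omega))

lemma mul_mul_le_balanced (a b c : ℕ) :
    a * b * c ≤ ((a + b + c) / 3) * ((a + b + c + 1) / 3) * ((a + b + c + 2) / 3) := by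
  have := le_balanced (n := a + b + c) (F := fun a b c => ((a * b * c : ℕ) : ℤ))
    (fun a b c => by push_cast; ring) (fun a b c => by push_cast; ring) ?_ a b c rfl
  · exact_mod_cast this
  · intro a b c _ h2 _
    obtain ⟨w, rfl⟩ := Nat.exists_eq_add_of_le h2
    have : a + 2 + w - 1 = a + 1 + w := by omega
    simp only [this]
    have : a * b * (a + 2 + w) ≤ (a + 1) * b * (a + 1 + w) := by nlinarith [Nat.zero_le (b * w)]
    exact_mod_cast this

/-- The sum of `φ` over the degrees of the complete tripartite graph with parts `a`, `b`, `c`. -/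
def triVal (n : ℕ) (φ : ℕ → ℤ) (a b c : ℕ) : ℤ :=
  a * φ (n - a) + b * φ (n - b) + c * φ (n - c)

/-- In `step` the sorted parts are `a`, `a + y`, `a + 2 + x`. The part `a + y` keeps its size and
degree in the move, so its term cancels. -/
theorem triVal_le {n : ℕ} {φ : ℕ → ℤ}
    (step : ∀ a x y : ℕ, 3 * a + 2 + x + y = n → a * φ (2 * a + 2 + x + y) +
      (a + 2 + x) * φ (2 * a + y) ≤ (a + 1) * φ (2 * a + 1 + x + y) + (a + 1 + x) * φ (2 * a + y + 1))
    {a b c : ℕ} (h : a + b + c = n) :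
    triVal n φ a b c ≤ triVal n φ (n / 3) ((n + 1) / 3) ((n + 2) / 3) := by
  refine le_balanced (fun a b c => by unfold triVal; ring) (fun a b c => by unfold triVal; ring)
    ?_ a b c h
  intro a b c h1 h2 h3
  obtain ⟨x, rfl⟩ := Nat.exists_eq_add_of_le h2
  obtain ⟨y, rfl⟩ := Nat.exists_eq_add_of_le h1
  have := step a x y (by omega)
  unfold triVal
  have e1 : n - a = 2 * a + 2 + x + y := by omega
  have e2 : n - (a + 2 + x) = 2 * a + y := by omega
  have e3 : n - (a + 1) = 2 * a + 1 + x + y := by omega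
  have e4 : n - (a + 2 + x - 1) = 2 * a + y + 1 := by omega
  have e5 : a + 2 + x - 1 = a + 1 + x := by omega
  rw [e1, e2, e3, e4, e5]
  push_cast
  linarith

theorem triVal_lt {n : ℕ} {φ : ℕ → ℤ}
    (step : ∀ a x y : ℕ, 3 * a + 2 + x + y = n → a * φ (2 * a + 2 + x + y) +
      (a + 2 + x) * φ (2 * a + y) < (a + 1) * φ (2 * a + 1 + x + y) + (a + 1 + x) * φ (2 * a + y + 1))
    {a b c : ℕ} (h : a + b + c = n)
    (hne : ¬ Balanced n a b c) :
    triVal n φ a b c < triVal n φ (n / 3) ((n + 1) / 3) ((n + 2) / 3) := by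
  refine lt_balanced (fun a b c => by unfold triVal; ring) (fun a b c => by unfold triVal; ring)
    ?_ a b c h hne
  intro a b c h1 h2 h3
  obtain ⟨x, rfl⟩ := Nat.exists_eq_add_of_le h2
  obtain ⟨y, rfl⟩ := Nat.exists_eq_add_of_le h1
  have := step a x y (by omega)
  unfold triVal
  have e1 : n - a = 2 * a + 2 + x + y := by omega
  have e2 : n - (a + 2 + x) = 2 * a + y := by omega
  have e3 : n - (a + 1) = 2 * a + 1 + x + y := by omega
  have e4 : n - (a + 2 + x - 1) = 2 * a + y + 1 := by omega
  have e5 : a + 2 + x - 1 = a + 1 + x := by omega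
  rw [e1, e2, e3, e4, e5]
  push_cast
  linarith

/-- The shifted degree power `(d - c) ^ j`, where the difference is truncated at `0`. -/
def shiftPow (c j d : ℕ) : ℤ := ((d - c : ℕ) : ℤ) ^ j

lemma shiftPow_mono (c j : ℕ) : Monotone (shiftPow c j) := fun a b h => by
  unfold shiftPow
  have : a - c ≤ b - c := by omega
  gcongr

lemma shiftPow_nonneg (c j d : ℕ) : 0 ≤ shiftPow c j d := by unfold shiftPow; positivity

/-- The shifts and orders for which the Turán graph maximises the sums of shifted degree powers. -/
def GoodShift (c n : ℕ) : Prop := c + 1 < n ∧ (c ≤ 1 ∨ c = 3 ∧ 12 ≤ n)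

/-- This is the range where truncation matters: the largest part has degree below `c`, so its terms
vanish before and after the move. Only the smallest part counts: its size grows by one while its
degree drops by one. -/
lemma shiftPow_step_small {c n j : ℕ} (hc : GoodShift c n) (hj : j = 1 ∨ j = 2 ∨ j = 3) (a x y : ℕ)
    (h : 3 * a + 2 + x + y = n) (hlt : 2 * a + y < c) :
    a * shiftPow c j (2 * a + 2 + x + y) + (a + 2 + x) * shiftPow c j (2 * a + y) <
      (a + 1) * shiftPow c j (2 * a + 1 + x + y) + (a + 1 + x) * shiftPow c j (2 * a + y + 1) := by
  have hj0 : j ≠ 0 := by omega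
  have z1 : shiftPow c j (2 * a + y) = 0 := by
    simp [shiftPow, Nat.sub_eq_zero_of_le hlt.le, hj0]
  have z2 : shiftPow c j (2 * a + y + 1) = 0 := by
    simp [shiftPow, Nat.sub_eq_zero_of_le (show 2 * a + y + 1 ≤ c by omega), hj0]
  rw [z1, z2]
  obtain ⟨hcn, hc⟩ := hc
  have ha : a = 0 ∨ a = 1 ∧ y = 0 ∧ c = 3 := by omega
  rcases ha with rfl | ⟨rfl, rfl, rfl⟩
  · have : 0 < shiftPow c j (2 * 0 + 1 + x + y) := by
      unfold shiftPow
      have : 0 < 2 * 0 + 1 + x + y - c := by omega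
      positivity
    push_cast
    linarith
  -- Here `n = 5 + x ≥ 12`, and the claim is `(u + 8) ^ j < 2 * (u + 7) ^ j`.
  · obtain ⟨u, rfl⟩ := Nat.exists_eq_add_of_le (show 7 ≤ x by omega)
    have e1 : 2 * 1 + 2 + (7 + u) + 0 - 3 = u + 8 := by omega
    have e2 : 2 * 1 + 1 + (7 + u) + 0 - 3 = u + 7 := by omega
    simp only [shiftPow, e1, e2]
    rcases hj with rfl | rfl | rfl <;> push_cast <;> nlinarith [sq_nonneg (u : ℤ), pow_nonneg (Nat.cast_nonneg (α := ℤ) u) 3]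

lemma shiftPow_one_step {c n : ℕ} (hc : GoodShift c n) (a x y : ℕ) (h : 3 * a + 2 + x + y = n) :
    a * shiftPow c 1 (2 * a + 2 + x + y) + (a + 2 + x) * shiftPow c 1 (2 * a + y) <
      (a + 1) * shiftPow c 1 (2 * a + 1 + x + y) + (a + 1 + x) * shiftPow c 1 (2 * a + y + 1) := by
  by_cases hlt : 2 * a + y < c
  · exact shiftPow_step_small hc (by simp) a x y h hlt
  obtain ⟨f, hf⟩ := Nat.exists_eq_add_of_le (not_lt.1 hlt)
  have e1 : 2 * a + 2 + x + y - c = f + x + 2 := by omega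
  have e2 : 2 * a + y - c = f := by omega
  have e3 : 2 * a + 1 + x + y - c = f + x + 1 := by omega
  have e4 : 2 * a + y + 1 - c = f + 1 := by omega
  simp only [shiftPow, e1, e2, e3, e4]
  push_cast
  nlinarith

lemma shiftPow_two_step {c n : ℕ} (hc : GoodShift c n) (a x y : ℕ) (h : 3 * a + 2 + x + y = n) :
    a * shiftPow c 2 (2 * a + 2 + x + y) + (a + 2 + x) * shiftPow c 2 (2 * a + y) ≤
      (a + 1) * shiftPow c 2 (2 * a + 1 + x + y) + (a + 1 + x) * shiftPow c 2 (2 * a + y + 1) := by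
  by_cases hlt : 2 * a + y < c
  · exact (shiftPow_step_small hc (by simp) a x y h hlt).le
  obtain ⟨f, hf⟩ := Nat.exists_eq_add_of_le (not_lt.1 hlt)
  have e1 : 2 * a + 2 + x + y - c = f + x + 2 := by omega
  have e2 : 2 * a + y - c = f := by omega
  have e3 : 2 * a + 1 + x + y - c = f + x + 1 := by omega
  have e4 : 2 * a + y + 1 - c = f + 1 := by omega
  simp only [shiftPow, e1, e2, e3, e4]
  -- The gain of the move factors as `(x + 1) * (x + 2 + 4 * f - 2 * a)`.
  have hk : 2 * a ≤ x + 2 + 4 * f := by obtain ⟨-, hc⟩ := hc; omega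
  have hk' : (0 : ℤ) ≤ x + 2 + 4 * f - 2 * a := by
    have : (2 * a : ℤ) ≤ x + 2 + 4 * f := by exact_mod_cast hk
    linarith
  have := mul_nonneg (show (0 : ℤ) ≤ x + 1 by positivity) hk'
  push_cast
  linarith

lemma shiftPow_two_step_lt {c n : ℕ} (hc : GoodShift c n) (hc1 : c ≤ 1) (a x y : ℕ)
    (h : 3 * a + 2 + x + y = n) :
    a * shiftPow c 2 (2 * a + 2 + x + y) + (a + 2 + x) * shiftPow c 2 (2 * a + y) <
      (a + 1) * shiftPow c 2 (2 * a + 1 + x + y) + (a + 1 + x) * shiftPow c 2 (2 * a + y + 1) := by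
  by_cases hlt : 2 * a + y < c
  · exact shiftPow_step_small hc (by simp) a x y h hlt
  obtain ⟨f, hf⟩ := Nat.exists_eq_add_of_le (not_lt.1 hlt)
  have e1 : 2 * a + 2 + x + y - c = f + x + 2 := by omega
  have e2 : 2 * a + y - c = f := by omega
  have e3 : 2 * a + 1 + x + y - c = f + x + 1 := by omega
  have e4 : 2 * a + y + 1 - c = f + 1 := by omega
  simp only [shiftPow, e1, e2, e3, e4]
  have hk : 2 * a < x + 2 + 4 * f := by omega
  have hk' : (0 : ℤ) < x + 2 + 4 * f - 2 * a := by
    have : (2 * a : ℤ) < x + 2 + 4 * f := by exact_mod_cast hk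
    linarith
  have := mul_pos (show (0 : ℤ) < x + 1 by positivity) hk'
  push_cast
  linarith

lemma shiftPow_three_step {c n : ℕ} (hc : GoodShift c n) (a x y : ℕ) (h : 3 * a + 2 + x + y = n) :
    a * shiftPow c 3 (2 * a + 2 + x + y) + (a + 2 + x) * shiftPow c 3 (2 * a + y) ≤
      (a + 1) * shiftPow c 3 (2 * a + 1 + x + y) + (a + 1 + x) * shiftPow c 3 (2 * a + y + 1) := by
  by_cases hlt : 2 * a + y < c
  · exact (shiftPow_step_small hc (by simp) a x y h hlt).le
  obtain ⟨f, hf⟩ := Nat.exists_eq_add_of_le (not_lt.1 hlt)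
  have e1 : 2 * a + 2 + x + y - c = f + x + 2 := by omega
  have e2 : 2 * a + y - c = f := by omega
  have e3 : 2 * a + 1 + x + y - c = f + x + 1 := by omega
  have e4 : 2 * a + y + 1 - c = f + 1 := by omega
  simp only [shiftPow, e1, e2, e3, e4]
  -- The gain of the move is `x + 1` times this expression, where `a + y - c = f - a`. The first
  -- factor can be negative only for `c = 3`, and then `12 ≤ n` makes `x` large enough.
  have hk : (0 : ℤ) ≤ ((a : ℤ) + y - c) * (6 * f + 3 * (x + 1) + 3) + (x + 1) ^ 2 + 1 := by
    obtain ⟨-, hc⟩ := hc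
    by_cases hay : c ≤ a + y
    · have : (0 : ℤ) ≤ (a : ℤ) + y - c := by
        have : (c : ℤ) ≤ a + y := by exact_mod_cast hay
        linarith
      positivity
    · have : c = 3 ∧ f ≤ 1 ∧ a + y = 2 ∧ 4 ≤ x := by omega
      obtain ⟨rfl, hf1, hay2, hx⟩ := this
      have e : (a : ℤ) + y = 2 := by exact_mod_cast hay2
      have hf1' : (f : ℤ) ≤ 1 := by exact_mod_cast hf1
      have hx' : (4 : ℤ) ≤ x := by exact_mod_cast hx
      rw [e]; push_cast; nlinarith
  have hfy : (y : ℤ) = c + f - 2 * a := by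
    have : (2 * a + y : ℤ) = c + f := by exact_mod_cast hf
    linarith
  rw [hfy] at hk
  have := mul_nonneg (show (0 : ℤ) ≤ x + 1 by positivity) hk
  push_cast
  linarith

end Smoothing

/-! ### Degree sums of the Turán graph and strictness away from it. -/

section Turan

lemma deg_eq_degree {V : Type*} [Fintype V] (G : SimpleGraph V) [DecidableRel G.Adj] (v : V) :
    deg G v = G.degree v := by
  classical
  rw [deg, ← SimpleGraph.card_neighborFinset_eq_degree, SimpleGraph.neighborFinset_eq_filter]
  congr

lemma sum_mod_three (n : ℕ) (F : ℕ → ℤ) :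
    ∑ v : Fin n, F (v % 3) =
      ((n + 2) / 3 : ℕ) * F 0 + ((n + 1) / 3 : ℕ) * F 1 + (n / 3 : ℕ) * F 2 := by
  induction n with
  | zero => simp
  | succ n ih =>
    rw [Fin.sum_univ_castSucc]
    simp only [Fin.val_castSucc, Fin.val_last]
    rw [ih]
    have h3 : n % 3 = 0 ∨ n % 3 = 1 ∨ n % 3 = 2 := by omega
    rcases h3 with h | h | h
    · have e1 : (n + 1 + 2) / 3 = (n + 2) / 3 + 1 := by omega
      have e2 : (n + 1 + 1) / 3 = (n + 1) / 3 := by omega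
      have e3 : (n + 1) / 3 = n / 3 := by omega
      rw [e1, e2, e3, h]; push_cast; ring
    · have e1 : (n + 1 + 2) / 3 = (n + 2) / 3 := by omega
      have e2 : (n + 1 + 1) / 3 = (n + 1) / 3 + 1 := by omega
      have e3 : (n + 1) / 3 = n / 3 := by omega
      rw [e1, e2, e3, h]; push_cast; ring
    · have e1 : (n + 1 + 2) / 3 = (n + 2) / 3 := by omega
      have e2 : (n + 1 + 1) / 3 = (n + 1) / 3 := by omega
      have e3 : (n + 1) / 3 = n / 3 + 1 := by omega
      rw [e1, e2, e3, h]; push_cast; ring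

/-- The degree in `T(n,3)` of the vertices of residue `r`. -/
def turanDeg (n r : ℕ) : ℕ :=
  if r = 0 then n - (n + 2) / 3 else if r = 1 then n - (n + 1) / 3 else n - n / 3

lemma deg_turanGraph {n : ℕ} (v : Fin n) :
    deg (SimpleGraph.turanGraph n 3) v = turanDeg n (v % 3) := by
  classical
  have h := sum_mod_three n (fun r => if (v : ℕ) % 3 ≠ r then 1 else 0)
  have h2 : ∑ u : Fin n, (if (v : ℕ) % 3 ≠ u % 3 then (1 : ℤ) else 0) =
      (deg (SimpleGraph.turanGraph n 3) v : ℤ) := by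
    rw [deg, card_filter]
    push_cast
    refine sum_congr rfl fun u _ => ?_
    simp only [SimpleGraph.turanGraph_adj]
  rw [h2] at h
  have h3 : (v : ℕ) % 3 = 0 ∨ (v : ℕ) % 3 = 1 ∨ (v : ℕ) % 3 = 2 := by omega
  rcases h3 with h3 | h3 | h3 <;> rw [h3] at h ⊢ <;> simp [turanDeg] at h ⊢ <;> omega

lemma arcSum_turanGraph (n : ℕ) (f : ℕ → ℕ → ℤ) :
    arcSum (SimpleGraph.turanGraph n 3) (fun u v => f (u % 3) (v % 3)) =
      ((n + 2) / 3 : ℕ) * ((n + 1) / 3 : ℕ) * (f 0 1 + f 1 0) +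
      ((n + 2) / 3 : ℕ) * (n / 3 : ℕ) * (f 0 2 + f 2 0) +
      ((n + 1) / 3 : ℕ) * (n / 3 : ℕ) * (f 1 2 + f 2 1) := by
  classical
  unfold arcSum
  have h1 : ∀ u : Fin n, (∑ v : Fin n,
      if (SimpleGraph.turanGraph n 3).Adj u v then f (u % 3) (v % 3) else 0) =
      (fun r => ∑ v : Fin n, (fun s => if r ≠ s then f r s else 0) ((v : ℕ) % 3)) ((u : ℕ) % 3) := by
    intro u
    refine sum_congr rfl fun v _ => ?_
    simp only [SimpleGraph.turanGraph_adj]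
  simp only [h1]
  rw [sum_mod_three n (fun r => ∑ v : Fin n, (fun s => if r ≠ s then f r s else 0) ((v : ℕ) % 3))]
  have h2 : ∀ r : ℕ, (∑ v : Fin n, if r ≠ (v : ℕ) % 3 then f r ((v : ℕ) % 3) else 0) = _ :=
    fun r => sum_mod_three n (fun s => if r ≠ s then f r s else 0)
  simp only [h2]
  simp
  ring

lemma arcSum_turanGraph_deg (n : ℕ) (f : ℕ → ℕ → ℤ) :
    arcSum (SimpleGraph.turanGraph n 3) (fun u v => f (deg (SimpleGraph.turanGraph n 3) u)
      (deg (SimpleGraph.turanGraph n 3) v)) =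
      ((n + 2) / 3 : ℕ) * ((n + 1) / 3 : ℕ) * (f (n - (n + 2) / 3) (n - (n + 1) / 3) +
        f (n - (n + 1) / 3) (n - (n + 2) / 3)) +
      ((n + 2) / 3 : ℕ) * (n / 3 : ℕ) * (f (n - (n + 2) / 3) (n - n / 3) +
        f (n - n / 3) (n - (n + 2) / 3)) +
      ((n + 1) / 3 : ℕ) * (n / 3 : ℕ) * (f (n - (n + 1) / 3) (n - n / 3) +
        f (n - n / 3) (n - (n + 1) / 3)) := by
  simp only [deg_turanGraph]
  exact arcSum_turanGraph n (fun r s => f (turanDeg n r) (turanDeg n s))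

lemma sum_deg_turanGraph (n : ℕ) (φ : ℕ → ℤ) :
    ∑ v, φ (deg (SimpleGraph.turanGraph n 3) v) = triVal n φ (n / 3) ((n + 1) / 3) ((n + 2) / 3) := by
  simp only [deg_turanGraph]
  rw [sum_mod_three n (fun r => φ (turanDeg n r))]
  simp only [turanDeg, triVal]
  simp
  ring

lemma triVal_eq_of_balanced {n a b c : ℕ} (φ : ℕ → ℤ) (h : a + b + c = n)
    (hb : Balanced n a b c) :
    triVal n φ a b c = triVal n φ (n / 3) ((n + 1) / 3) ((n + 2) / 3) := by
  unfold Balanced at hb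
  set x := n / 3 with hx
  set y := (n + 1) / 3 with hy
  set z := (n + 2) / 3 with hz
  have : (a = x ∧ b = y ∧ c = z) ∨ (a = x ∧ b = z ∧ c = y) ∨ (a = y ∧ b = x ∧ c = z) ∨
    (a = y ∧ b = z ∧ c = x) ∨ (a = z ∧ b = x ∧ c = y) ∨ (a = z ∧ b = y ∧ c = x) := by omega
  unfold triVal
  rcases this with ⟨rfl, rfl, rfl⟩ | ⟨rfl, rfl, rfl⟩ | ⟨rfl, rfl, rfl⟩ | ⟨rfl, rfl, rfl⟩ |
    ⟨rfl, rfl, rfl⟩ | ⟨rfl, rfl, rfl⟩ <;> ring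

lemma nonempty_iso_of_sum_deg {n : ℕ} {G : SimpleGraph (Fin n)} (hG : G.CliqueFree 4)
    (h : ∑ v, deg G v = ∑ v, deg (SimpleGraph.turanGraph n 3) v) :
    Nonempty (G ≃g SimpleGraph.turanGraph n 3) := by
  classical
  have hT := SimpleGraph.isTuranMaximal_turanGraph (n := n) (r := 3) (by norm_num)
  have key : G.IsTuranMaximal 3 := by
    refine ⟨hG, fun H _ hH => (hT.2 hH).trans ?_⟩
    have h1 := G.sum_degrees_eq_twice_card_edges
    have h2 := (SimpleGraph.turanGraph n 3).sum_degrees_eq_twice_card_edges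
    simp only [deg_eq_degree] at h
    omega
  have := (SimpleGraph.isTuranMaximal_iff_nonempty_iso_turanGraph (G := G) (r := 3)
    (by norm_num)).1 key
  rwa [Fintype.card_fin] at this

lemma sum_deg_le {n : ℕ} {G : SimpleGraph (Fin n)} (hG : G.CliqueFree 4) :
    ∑ v, deg G v ≤ ∑ v, deg (SimpleGraph.turanGraph n 3) v := by
  classical
  have hT := SimpleGraph.isTuranMaximal_turanGraph (n := n) (r := 3) (by norm_num)
  have h0 := hT.2 hG
  have h1 := G.sum_degrees_eq_twice_card_edges
  have h2 := (SimpleGraph.turanGraph n 3).sum_degrees_eq_twice_card_edges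
  simp only [deg_eq_degree]
  omega

/-- The last clause supplies strictness when the majorizing parts are already balanced. If no degree
fell short of its majorant, `G` would have as many edges as the Turán graph, and uniqueness in
Turán's theorem would make them isomorphic. -/
theorem exists_triVal {n : ℕ} {G : SimpleGraph (Fin n)} (hG : G.CliqueFree 4) :
    ∃ a b c : ℕ, a + b + c = n ∧
      (∀ φ : ℕ → ℤ, Monotone φ → ∑ v, φ (deg G v) ≤ triVal n φ a b c) ∧
      (Balanced n a b c →
        ¬ Nonempty (G ≃g SimpleGraph.turanGraph n 3) → ∀ φ : ℕ → ℤ, Monotone φ →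
        (∀ d e, d < e → n - (n + 2) / 3 ≤ e → φ d < φ e) → ∑ v, φ (deg G v) < triVal n φ a b c) := by
  obtain ⟨a, b, c, D, hs, hD, hDv, hφ⟩ := exists_deg_le hG
  rw [Fintype.card_fin] at hs hDv hφ
  refine ⟨a, b, c, hs, fun φ hm => ?_, fun hb hne φ hm hst => ?_⟩
  · rw [triVal, ← hφ]
    exact sum_le_sum fun v _ => hm (hD v)
  · rw [triVal, ← hφ]
    refine sum_lt_sum (fun v _ => hm (hD v)) ?_
    by_contra hcon
    apply hne
    apply nonempty_iso_of_sum_deg hG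
    have : ∀ v, deg G v = D v := by
      intro v
      by_contra hv
      -- With balanced parts every majorant is at least the minimum degree of the Turán graph, so
      -- strict growth of `φ` is only needed there. This permits truncated powers.
      exact hcon ⟨v, mem_univ v, hst _ _ (lt_of_le_of_ne (hD v) hv) (by
        unfold Balanced at hb; rcases hDv v with h | h | h <;> omega)⟩
    have e1 := hφ (fun d => (d : ℤ))
    have e2 := sum_deg_turanGraph n (fun d => (d : ℤ))
    have e3 := triVal_eq_of_balanced (fun d => (d : ℤ)) hs hb
    rw [← e2, triVal, ← e1] at e3
    simp only [this]
    exact_mod_cast e3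

theorem sum_shiftPow_le {n c : ℕ} (hc : GoodShift c n) {G : SimpleGraph (Fin n)}
    (hG : G.CliqueFree 4) {j : ℕ} (hj : j = 1 ∨ j = 2 ∨ j = 3) :
    ∑ v, shiftPow c j (deg G v) ≤ triVal n (shiftPow c j) (n / 3) ((n + 1) / 3) ((n + 2) / 3) := by
  obtain ⟨x, y, z, hs, h, -⟩ := exists_triVal hG
  refine (h _ (shiftPow_mono c j)).trans (triVal_le ?_ hs)
  rcases hj with rfl | rfl | rfl
  · exact fun a x y h => (shiftPow_one_step hc a x y h).le
  · exact shiftPow_two_step hc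
  · exact shiftPow_three_step hc

lemma shiftPow_lt {c d e j : ℕ} (hj : j ≠ 0) (hde : d < e) (he : c < e) :
    shiftPow c j d < shiftPow c j e := by
  have : d - c < e - c := by omega
  unfold shiftPow
  exact pow_lt_pow_left₀ (by exact_mod_cast this) (by positivity) hj

theorem sum_shiftPow_lt {n c : ℕ} (hc : GoodShift c n) {G : SimpleGraph (Fin n)}
    (hG : G.CliqueFree 4) (hne : ¬ Nonempty (G ≃g SimpleGraph.turanGraph n 3)) {j : ℕ}
    (hj : j = 1 ∨ j = 2 ∧ c ≤ 1) :
    ∑ v, shiftPow c j (deg G v) <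
      triVal n (shiftPow c j) (n / 3) ((n + 1) / 3) ((n + 2) / 3) := by
  obtain ⟨x, y, z, hs, h, h'⟩ := exists_triVal hG
  by_cases hb : Balanced n x y z
  · rw [← triVal_eq_of_balanced _ hs hb]
    refine h' hb hne _ (shiftPow_mono c j) fun d e hde he => shiftPow_lt (by omega) hde ?_
    obtain ⟨h1, h2⟩ := hc
    omega
  · refine (h _ (shiftPow_mono c j)).trans_lt (triVal_lt ?_ hs hb)
    rcases hj with rfl | ⟨rfl, hc1⟩
    · exact shiftPow_one_step hc
    · exact shiftPow_two_step_lt hc hc1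

end Turan

/-! ### Sums over ordered adjacent pairs and their relation to edge indices. -/

section ArcSum

variable {V : Type*} [Fintype V]

lemma arcSum_congr {G : SimpleGraph V} {f g : V → V → ℤ} (h : ∀ u v, G.Adj u v → f u v = g u v) :
    arcSum G f = arcSum G g := by
  classical
  refine sum_congr rfl fun u _ => sum_congr rfl fun v _ => ?_
  split_ifs with huv
  exacts [h u v huv, rfl]

lemma arcSum_le_arcSum {G : SimpleGraph V} {f g : V → V → ℤ} (h : ∀ u v, G.Adj u v → f u v ≤ g u v) :
    arcSum G f ≤ arcSum G g := by
  classical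
  refine sum_le_sum fun u _ => sum_le_sum fun v _ => ?_
  split_ifs with huv
  exacts [h u v huv, le_rfl]

lemma arcSum_nonneg {G : SimpleGraph V} {f : V → V → ℤ} (h : ∀ u v, 0 ≤ f u v) :
    0 ≤ arcSum G f := by
  classical
  refine sum_nonneg fun u _ => sum_nonneg fun v _ => ?_
  split_ifs
  exacts [h u v, le_rfl]

lemma arcSum_add (G : SimpleGraph V) (f g : V → V → ℤ) :
    arcSum G (fun u v => f u v + g u v) = arcSum G f + arcSum G g := by
  classical
  simp only [arcSum, ← sum_add_distrib]
  refine sum_congr rfl fun u _ => sum_congr rfl fun v _ => ?_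
  split_ifs <;> simp

lemma arcSum_mul (G : SimpleGraph V) (a : ℤ) (f : V → V → ℤ) :
    arcSum G (fun u v => a * f u v) = a * arcSum G f := by
  classical
  simp only [arcSum, mul_sum]
  refine sum_congr rfl fun u _ => sum_congr rfl fun v _ => ?_
  split_ifs <;> simp

lemma arcSum_swap (G : SimpleGraph V) (f : V → V → ℤ) :
    arcSum G (fun u v => f v u) = arcSum G f := by
  classical
  unfold arcSum
  rw [sum_comm]
  simp only [G.adj_comm]

lemma arcSum_left (G : SimpleGraph V) (φ : V → ℤ) :
    arcSum G (fun u _ => φ u) = ∑ u, deg G u * φ u := by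
  classical
  unfold arcSum deg
  refine sum_congr rfl fun u _ => ?_
  rw [← sum_filter, sum_const, nsmul_eq_mul]

lemma arcSum_add_swap (G : SimpleGraph V) (φ : V → ℤ) :
    arcSum G (fun u v => φ u + φ v) = 2 * ∑ u, deg G u * φ u := by
  rw [arcSum_add, arcSum_swap G (fun u _ => φ u), arcSum_left]; ring

lemma deg_pos_of_adj {G : SimpleGraph V} {u v : V} (h : G.Adj u v) : 0 < deg G u := by
  classical
  exact card_pos.2 ⟨v, by simpa using h⟩

lemma deg_lt_card (G : SimpleGraph V) (u : V) : deg G u < Fintype.card V := by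
  classical
  exact card_lt_univ_of_notMem (x := u) (by simp)

variable {W : Type*} [Fintype W]

lemma deg_iso {G : SimpleGraph V} {H : SimpleGraph W} (e : G ≃g H) (v : V) :
    deg H (e v) = deg G v := by
  classical
  symm
  refine card_bij (fun u _ => e u) ?_ ?_ ?_
  · intro u hu
    simp only [mem_filter, mem_univ, true_and] at hu ⊢
    exact e.map_adj_iff.2 hu
  · intro a _ b _ h; exact e.injective h
  · intro b hb
    refine ⟨e.symm b, ?_, by simp⟩
    simp only [mem_filter, mem_univ, true_and] at hb ⊢
    rw [← e.map_adj_iff]; simpa using hb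

lemma arcSum_iso {G : SimpleGraph V} {H : SimpleGraph W} (e : G ≃g H) (f : ℕ → ℕ → ℤ) :
    arcSum G (fun u v => f (deg G u) (deg G v)) = arcSum H (fun u v => f (deg H u) (deg H v)) := by
  classical
  unfold arcSum
  refine Fintype.sum_equiv e.toEquiv _ _ fun u => Fintype.sum_equiv e.toEquiv _ _ fun v => ?_
  have h1 : deg H (e.toEquiv u) = deg G u := deg_iso e u
  have h2 : deg H (e.toEquiv v) = deg G v := deg_iso e v
  have h3 : H.Adj (e.toEquiv u) (e.toEquiv v) ↔ G.Adj u v := e.map_adj_iff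
  simp only [h1, h2, h3]

open Classical in
lemma two_mul_sum_edgeFinset (G : SimpleGraph V) (F : Sym2 V → ℤ) :
    2 * ∑ e ∈ G.edgeFinset, F e = arcSum G (fun u v => F s(u, v)) := by
  have h1 : ∑ d : G.Dart, F d.edge = 2 * ∑ e ∈ G.edgeFinset, F e := by
    rw [← sum_fiberwise_of_maps_to (s := univ) (t := G.edgeFinset) (g := fun d : G.Dart => d.edge)
      (fun d _ => by rw [SimpleGraph.mem_edgeFinset]; exact d.edge_mem), mul_sum]
    refine sum_congr rfl fun e he => ?_
    rw [sum_congr rfl (g := fun _ => F e) (fun d hd => by rw [(mem_filter.1 hd).2]), sum_const,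
      G.dart_edge_fiber_card e (SimpleGraph.mem_edgeFinset.1 he)]
    simp
  rw [← h1, arcSum, ← sum_product', ← sum_filter]
  refine sum_bij (fun d _ => d.toProd) ?_ ?_ ?_ ?_
  · intro d _; simp
  · intro a _ b _ h; exact SimpleGraph.Dart.ext _ _ h
  · intro b hb; exact ⟨⟨b, by simpa using hb⟩, mem_univ _, rfl⟩
  · intro d _; rfl

lemma two_mul_value_overEdges (G : SimpleGraph V) (p : MvPolynomial (Fin 2) ℤ)
    (symm : ∀ x y : ℤ, p.eval ![x, y] = p.eval ![y, x]) :
    2 * (DegreeIndex.overEdges p symm).value G =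
      arcSum G (fun u v => p.eval ![(deg G u : ℤ), (deg G v : ℤ)]) := by
  classical
  rw [DegreeIndex.value, two_mul_sum_edgeFinset]
  refine arcSum_congr fun u v _ => ?_
  simp only [deg_eq_degree, Sym2.lift_mk]

lemma value_overVertices (G : SimpleGraph V) (p : Polynomial ℤ) :
    (DegreeIndex.overVertices p).value G = ∑ v, p.eval (deg G v : ℤ) := by
  classical
  rw [DegreeIndex.value]
  simp only [deg_eq_degree]

end ArcSum

/-! ### Edge sums of monomials in shifted degrees. -/

section Values

lemma turan_parts {n c : ℕ} (hc : c + (n + 2) / 3 ≤ n) : ∃ k : ℕ,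
    (((n / 3 : ℕ) : ℤ) = k ∧ (((n + 1) / 3 : ℕ) : ℤ) = k ∧ (((n + 2) / 3 : ℕ) : ℤ) = k ∧
      ((n - n / 3 - c : ℕ) : ℤ) = 2 * k - c ∧ ((n - (n + 1) / 3 - c : ℕ) : ℤ) = 2 * k - c ∧
      ((n - (n + 2) / 3 - c : ℕ) : ℤ) = 2 * k - c ∧ n = 3 * k) ∨
    (((n / 3 : ℕ) : ℤ) = k ∧ (((n + 1) / 3 : ℕ) : ℤ) = k ∧ (((n + 2) / 3 : ℕ) : ℤ) = k + 1 ∧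
      ((n - n / 3 - c : ℕ) : ℤ) = 2 * k + 1 - c ∧ ((n - (n + 1) / 3 - c : ℕ) : ℤ) = 2 * k + 1 - c ∧
      ((n - (n + 2) / 3 - c : ℕ) : ℤ) = 2 * k - c ∧ n = 3 * k + 1) ∨
    (((n / 3 : ℕ) : ℤ) = k ∧ (((n + 1) / 3 : ℕ) : ℤ) = k + 1 ∧ (((n + 2) / 3 : ℕ) : ℤ) = k + 1 ∧
      ((n - n / 3 - c : ℕ) : ℤ) = 2 * k + 2 - c ∧ ((n - (n + 1) / 3 - c : ℕ) : ℤ) = 2 * k + 1 - c ∧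
      ((n - (n + 2) / 3 - c : ℕ) : ℤ) = 2 * k + 1 - c ∧ n = 3 * k + 2) := by
  refine ⟨n / 3, ?_⟩
  have : n % 3 = 0 ∨ n % 3 = 1 ∨ n % 3 = 2 := by omega
  rcases this with h | h | h
  · left; omega
  · right; left; omega
  · right; right; omega

/-- The shifted degree, truncated at `0`. -/
noncomputable def sdeg {V : Type*} [Fintype V] (c : ℕ) (G : SimpleGraph V) (v : V) : ℤ :=
  ((deg G v - c : ℕ) : ℤ)

variable {V : Type*} [Fintype V]

lemma sdeg_nonneg (c : ℕ) (G : SimpleGraph V) (v : V) : 0 ≤ sdeg c G v := by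
  unfold sdeg; positivity

lemma sum_sdeg_pow (c j : ℕ) (G : SimpleGraph V) :
    ∑ v, sdeg c G v ^ j = ∑ v, shiftPow c j (deg G v) := rfl

/-- The positive exponent matters: when the degree is at most `c`, all terms vanish despite the
truncation. -/
lemma deg_mul_sdeg_pow (c j : ℕ) (G : SimpleGraph V) (v : V) :
    deg G v * sdeg c G v ^ (j + 1) = sdeg c G v ^ (j + 2) + c * sdeg c G v ^ (j + 1) := by
  unfold sdeg
  rcases le_total c (deg G v) with h | h
  · rw [Nat.cast_sub h]; ring
  · simp [Nat.sub_eq_zero_of_le h]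

/-- The sum of a monomial in the shifted degrees of the ends over all ordered pairs of adjacent
vertices. -/
noncomputable def mono (c i j : ℕ) (G : SimpleGraph V) : ℤ :=
  arcSum G (fun u v => sdeg c G u ^ i * sdeg c G v ^ j)

lemma mono_zero_right (c j : ℕ) (G : SimpleGraph V) :
    mono c (j + 1) 0 G = ∑ v, shiftPow c (j + 2) (deg G v) + c * ∑ v, shiftPow c (j + 1) (deg G v) := by
  unfold mono
  simp only [pow_zero, mul_one]
  rw [arcSum_left]
  simp only [deg_mul_sdeg_pow, sum_add_distrib, ← mul_sum]
  rfl

lemma mono_iso {W : Type*} [Fintype W] {G : SimpleGraph V} {H : SimpleGraph W} (e : G ≃g H)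
    (c i j : ℕ) : mono c i j G = mono c i j H :=
  arcSum_iso e (fun x y => ((x - c : ℕ) : ℤ) ^ i * ((y - c : ℕ) : ℤ) ^ j)

lemma mono_nonneg (c i j : ℕ) (G : SimpleGraph V) : 0 ≤ mono c i j G :=
  arcSum_nonneg fun _ _ => mul_nonneg (pow_nonneg (sdeg_nonneg _ _ _) _)
    (pow_nonneg (sdeg_nonneg _ _ _) _)

lemma mono_comm (c i j : ℕ) (G : SimpleGraph V) : mono c i j G = mono c j i G := by
  unfold mono
  rw [← arcSum_swap]
  exact arcSum_congr fun u v _ => mul_comm _ _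

lemma three_mul_mono_le (c j : ℕ) {G : SimpleGraph V} (hG : G.CliqueFree 4) :
    3 * mono c j j G ≤ 2 * (∑ v, shiftPow c j (deg G v)) ^ 2 := by
  rw [← sum_sdeg_pow]
  exact three_mul_arcSum_le hG fun v => pow_nonneg (sdeg_nonneg _ _ _) _

/-- Sum `(4ab - m(a + b)) ^ 2 ≥ 0` over adjacent pairs. Little is lost if `m` is close to `4ab / (a
+ b)`, which is twice the shifted degree when `a = b`. -/
lemma mono_two_one_le (c : ℕ) (m : ℤ) (G : SimpleGraph V) :
    8 * m * mono c 2 1 G ≤ 8 * mono c 2 2 G + m ^ 2 * mono c 2 0 G + m ^ 2 * mono c 1 1 G := by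
  have h : arcSum G (fun u v => 8 * m * (sdeg c G u * sdeg c G v * (sdeg c G u + sdeg c G v))) ≤
      arcSum G (fun u v => 16 * (sdeg c G u ^ 2 * sdeg c G v ^ 2) +
        m ^ 2 * (sdeg c G u + sdeg c G v) ^ 2) :=
    arcSum_le_arcSum fun u v _ => by
      nlinarith [sq_nonneg (4 * (sdeg c G u * sdeg c G v) - m * (sdeg c G u + sdeg c G v))]
  have e1 : arcSum G (fun u v => 8 * m * (sdeg c G u * sdeg c G v * (sdeg c G u + sdeg c G v))) =
      16 * m * mono c 2 1 G := by
    rw [arcSum_mul]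
    have : arcSum G (fun u v => sdeg c G u * sdeg c G v * (sdeg c G u + sdeg c G v)) =
        mono c 2 1 G + mono c 1 2 G := by
      unfold mono; rw [← arcSum_add]; exact arcSum_congr fun u v _ => by ring
    rw [this, mono_comm c 1 2]; ring
  have e2 : arcSum G (fun u v => 16 * (sdeg c G u ^ 2 * sdeg c G v ^ 2) +
        m ^ 2 * (sdeg c G u + sdeg c G v) ^ 2) =
      16 * mono c 2 2 G + m ^ 2 * (2 * mono c 2 0 G + 2 * mono c 1 1 G) := by
    rw [arcSum_add, arcSum_mul, arcSum_mul]
    have : arcSum G (fun u v => (sdeg c G u + sdeg c G v) ^ 2) =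
        mono c 2 0 G + mono c 0 2 G + 2 * mono c 1 1 G := by
      unfold mono; rw [← arcSum_mul, ← arcSum_add, ← arcSum_add]
      exact arcSum_congr fun u v _ => by ring
    rw [this, mono_comm c 0 2]; unfold mono; ring
  rw [e1, e2] at h
  linarith

/-- In a `K₄`-free graph on `n` vertices, the edge sums of the products of shifted
degrees are bounded by those of the Turán graph. -/
theorem mono_le_turanGraph {n : ℕ} {G : SimpleGraph (Fin n)} (hG : G.CliqueFree 4) :
    mono 1 0 0 G ≤ mono 1 0 0 (SimpleGraph.turanGraph n 3) ∧
    mono 1 1 0 G ≤ mono 1 1 0 (SimpleGraph.turanGraph n 3) ∧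
    mono 1 2 0 G ≤ mono 1 2 0 (SimpleGraph.turanGraph n 3) ∧
    mono 1 1 1 G ≤ mono 1 1 1 (SimpleGraph.turanGraph n 3) ∧
    mono 1 2 1 G ≤ mono 1 2 1 (SimpleGraph.turanGraph n 3) ∧
    mono 1 2 2 G ≤ mono 1 2 2 (SimpleGraph.turanGraph n 3) := by
  by_cases hiso : Nonempty (G ≃g SimpleGraph.turanGraph n 3)
  · obtain ⟨e⟩ := hiso
    simp only [mono_iso e, le_refl, and_self]
  have h00 : mono 1 0 0 G ≤ mono 1 0 0 (SimpleGraph.turanGraph n 3) := by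
    unfold mono
    simp only [pow_zero, mul_one]
    rw [arcSum_left, arcSum_left]
    simp only [mul_one]
    exact_mod_cast sum_deg_le hG
  refine ⟨h00, ?_⟩
  -- Degrees are then at most 1, so all shifted degrees vanish.
  by_cases hn : n ≤ 2
  · have hz : ∀ v, sdeg 1 G v = 0 := fun v => by
      have := deg_lt_card G v
      rw [Fintype.card_fin] at this
      simp only [sdeg]; norm_cast; omega
    have : ∀ i j, mono 1 (i + 1) j G = 0 := fun i j => by
      unfold mono
      simp [hz, arcSum]
    refine ⟨?_, ?_, ?_, ?_, ?_⟩ <;> rw [this] <;> exact mono_nonneg _ _ _ _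
  have hc : GoodShift 1 n := ⟨by omega, by omega⟩
  have s1 := sum_shiftPow_lt hc hG hiso (j := 1) (by simp)
  have s2 := sum_shiftPow_lt hc hG hiso (j := 2) (by simp)
  have s3 := sum_shiftPow_le hc hG (j := 3) (by simp)
  have s1' := sum_deg_turanGraph n (shiftPow 1 1)
  have s2' := sum_deg_turanGraph n (shiftPow 1 2)
  have s3' := sum_deg_turanGraph n (shiftPow 1 3)
  have p1 : 0 ≤ ∑ v, shiftPow 1 1 (deg G v) := sum_nonneg fun v _ => shiftPow_nonneg _ _ _
  have p2 : 0 ≤ ∑ v, shiftPow 1 2 (deg G v) := sum_nonneg fun v _ => shiftPow_nonneg _ _ _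
  have h10 : mono 1 1 0 G ≤ mono 1 1 0 (SimpleGraph.turanGraph n 3) := by
    rw [mono_zero_right, mono_zero_right, s1', s2']; push_cast; linarith
  have h20 : mono 1 2 0 G ≤ mono 1 2 0 (SimpleGraph.turanGraph n 3) := by
    rw [mono_zero_right, mono_zero_right, s2', s3']; push_cast; linarith
  have h11 := three_mul_mono_le 1 1 hG
  have h22 := three_mul_mono_le 1 2 hG
  -- The strict inequalities become a deficit of one by integrality; this absorbs the gap in
  -- Motzkin–Straus when the parts are unequal.
  have q1 : (∑ v, shiftPow 1 1 (deg G v)) ^ 2 ≤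
      (triVal n (shiftPow 1 1) (n / 3) ((n + 1) / 3) ((n + 2) / 3) - 1) ^ 2 := by
    gcongr; linarith
  have q2 : (∑ v, shiftPow 1 2 (deg G v)) ^ 2 ≤
      (triVal n (shiftPow 1 2) (n / 3) ((n + 1) / 3) ((n + 2) / 3) - 1) ^ 2 := by
    gcongr; linarith
  have t20 := mono_zero_right 1 1 (SimpleGraph.turanGraph n 3)
  rw [s2', s3'] at t20
  have t11 : mono 1 1 1 (SimpleGraph.turanGraph n 3) = _ :=
    arcSum_turanGraph_deg n (fun x y => ((x - 1 : ℕ) : ℤ) ^ 1 * ((y - 1 : ℕ) : ℤ) ^ 1)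
  have t22 : mono 1 2 2 (SimpleGraph.turanGraph n 3) = _ :=
    arcSum_turanGraph_deg n (fun x y => ((x - 1 : ℕ) : ℤ) ^ 2 * ((y - 1 : ℕ) : ℤ) ^ 2)
  have t21 : mono 1 2 1 (SimpleGraph.turanGraph n 3) = _ :=
    arcSum_turanGraph_deg n (fun x y => ((x - 1 : ℕ) : ℤ) ^ 2 * ((y - 1 : ℕ) : ℤ) ^ 1)
  generalize ∑ v, shiftPow 1 1 (deg G v) = Q1 at *
  generalize ∑ v, shiftPow 1 2 (deg G v) = Q2 at *
  simp only [triVal, shiftPow] at q1 q2 t20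
  obtain ⟨k, hk⟩ := turan_parts (n := n) (c := 1) (by omega)
  have hk1 : 1 ≤ k := by omega
  obtain ⟨l, rfl⟩ := Nat.exists_eq_add_of_le hk1
  have hl := fun i => pow_nonneg (Nat.cast_nonneg (α := ℤ) l) i
  -- The chosen `m` is the sum of the two smallest shifted degrees over the three parts of the Turán
  -- graph. After substituting `k = 1 + l`, the inequalities follow linearly from non-negativity of
  -- the powers of `l`.
  have main : ∃ m : ℤ, 0 < m ∧ 2 * Q1 ^ 2 ≤
        3 * mono 1 1 1 (SimpleGraph.turanGraph n 3) ∧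
      2 * Q2 ^ 2 ≤ 3 * mono 1 2 2 (SimpleGraph.turanGraph n 3) ∧
      16 * Q2 ^ 2 + 3 * m ^ 2 * mono 1 2 0 (SimpleGraph.turanGraph n 3)
        + 2 * m ^ 2 * Q1 ^ 2 ≤
        24 * m * mono 1 2 1 (SimpleGraph.turanGraph n 3) := by
    rcases hk with ⟨a1, a2, a3, b1, b2, b3, -⟩ | ⟨a1, a2, a3, b1, b2, b3, -⟩ |
      ⟨a1, a2, a3, b1, b2, b3, -⟩ <;> rw [a1, a2, a3, b1, b2, b3] at q1 q2 t20 t11 t22 t21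
    · refine ⟨4 * (1 + l) - 2, by linarith [hl 1], ?_, ?_, ?_⟩
      · rw [t11]; push_cast at *; linarith [hl 1, hl 2, hl 3, hl 4]
      · rw [t22]; push_cast at *; linarith [hl 1, hl 2, hl 3, hl 4, hl 5, hl 6]
      · rw [t21, t20]
        have q1' := mul_le_mul_of_nonneg_left q1 (sq_nonneg (4 * (1 + l : ℤ) - 2))
        push_cast at *; linarith [hl 1, hl 2, hl 3, hl 4, hl 5, hl 6]
    · refine ⟨4 * (1 + l) - 1, by linarith [hl 1], ?_, ?_, ?_⟩
      · rw [t11]; push_cast at *; linarith [hl 1, hl 2, hl 3, hl 4]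
      · rw [t22]; push_cast at *; linarith [hl 1, hl 2, hl 3, hl 4, hl 5, hl 6]
      · rw [t21, t20]
        have q1' := mul_le_mul_of_nonneg_left q1 (sq_nonneg (4 * (1 + l : ℤ) - 1))
        push_cast at *; linarith [hl 1, hl 2, hl 3, hl 4, hl 5, hl 6]
    · refine ⟨4 * (1 + l), by linarith [hl 1], ?_, ?_, ?_⟩
      · rw [t11]; push_cast at *; linarith [hl 1, hl 2, hl 3, hl 4]
      · rw [t22]; push_cast at *; linarith [hl 1, hl 2, hl 3, hl 4, hl 5, hl 6]
      · rw [t21, t20]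
        have q1' := mul_le_mul_of_nonneg_left q1 (sq_nonneg (4 * (1 + l : ℤ)))
        push_cast at *; linarith [hl 1, hl 2, hl 3, hl 4, hl 5, hl 6]
  obtain ⟨m, hm, m1, m2, m3⟩ := main
  have h21 := mono_two_one_le 1 m G
  refine ⟨h10, h20, by linarith, ?_, by linarith⟩
  have z1 := mul_le_mul_of_nonneg_left h20 (sq_nonneg m)
  have z2 := mul_le_mul_of_nonneg_left h11 (sq_nonneg m)
  have : (24 * m) * mono 1 2 1 G ≤ (24 * m) * mono 1 2 1 (SimpleGraph.turanGraph n 3) := by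
    linarith
  exact le_of_mul_le_mul_left this (by linarith)

end Values

/-! ### The indices of `A0'`. -/

section Indices

/-- Taking the coefficients in `ℕ` encodes their non-negativity, so the bounds for single monomials
add up. The shift by 1 is not truncated here, since ends of edges have positive degree. -/
lemma value_overEdges_le {p : MvPolynomial (Fin 2) ℤ}
    {symm : ∀ x y : ℤ, p.eval ![x, y] = p.eval ![y, x]} (c₀₀ c₁₀ c₂₀ c₁₁ c₂₁ c₂₂ : ℕ)
    (hp : ∀ a b : ℤ, p.eval ![a + 1, b + 1] = c₀₀ + c₁₀ * (a + b) + c₂₀ * (a ^ 2 + b ^ 2) +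
      c₁₁ * (a * b) + c₂₁ * (a ^ 2 * b + b ^ 2 * a) + c₂₂ * (a ^ 2 * b ^ 2))
    {n : ℕ} {G : SimpleGraph (Fin n)} (hG : G.CliqueFree 4) :
    (DegreeIndex.overEdges p symm).value G ≤
      (DegreeIndex.overEdges p symm).value (SimpleGraph.turanGraph n 3) := by
  have key : ∀ H : SimpleGraph (Fin n), 2 * (DegreeIndex.overEdges p symm).value H =
      c₀₀ * mono 1 0 0 H + c₁₀ * (2 * mono 1 1 0 H) + c₂₀ * (2 * mono 1 2 0 H) +
      c₁₁ * mono 1 1 1 H + c₂₁ * (2 * mono 1 2 1 H) + c₂₂ * mono 1 2 2 H := by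
    intro H
    have e1 : 2 * mono 1 1 0 H = mono 1 1 0 H + mono 1 0 1 H := by rw [mono_comm 1 0 1]; ring
    have e2 : 2 * mono 1 2 0 H = mono 1 2 0 H + mono 1 0 2 H := by rw [mono_comm 1 0 2]; ring
    have e3 : 2 * mono 1 2 1 H = mono 1 2 1 H + mono 1 1 2 H := by rw [mono_comm 1 1 2]; ring
    rw [two_mul_value_overEdges, e1, e2, e3]
    unfold mono
    simp only [← arcSum_add, ← arcSum_mul]
    refine arcSum_congr fun u v huv => ?_
    have hd : ∀ w, 0 < deg H w → (deg H w : ℤ) = sdeg 1 H w + 1 := fun w hw => by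
      unfold sdeg; omega
    rw [hd u (deg_pos_of_adj huv), hd v (deg_pos_of_adj huv.symm), hp]
    ring
  obtain ⟨h00, h10, h20, h11, h21, h22⟩ := mono_le_turanGraph hG
  have h : 2 * (DegreeIndex.overEdges p symm).value G ≤
      2 * (DegreeIndex.overEdges p symm).value (SimpleGraph.turanGraph n 3) := by
    rw [key, key]; gcongr
  linarith

lemma value_overVertices_pow_le {r : ℕ} (hr : r ≤ 2) {n : ℕ} {G : SimpleGraph (Fin n)}
    (hG : G.CliqueFree 4) :
    (DegreeIndex.overVertices (Polynomial.X ^ r)).value G ≤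
      (DegreeIndex.overVertices (Polynomial.X ^ r)).value (SimpleGraph.turanGraph n 3) := by
  rw [value_overVertices, value_overVertices]
  simp only [Polynomial.eval_pow, Polynomial.eval_X]
  by_cases hn : n ≤ 1
  · have : ∀ (H : SimpleGraph (Fin n)) v, deg H v = 0 := fun H v => by
      have := deg_lt_card H v
      rw [Fintype.card_fin] at this
      omega
    simp only [this, le_refl]
  · rcases Nat.eq_zero_or_pos r with rfl | hr0
    · simp
    · have := sum_shiftPow_le (c := 0) ⟨by omega, by omega⟩ hG (j := r) (by omega)
      rw [← sum_deg_turanGraph] at this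
      exact this

open DegreeIndex in
theorem value_le_turanGraph {Q : DegreeIndex} (hQ : Q.A0') {n : ℕ} {G : SimpleGraph (Fin n)}
    (hG : G.CliqueFree 4) : Q.value G ≤ Q.value (SimpleGraph.turanGraph n 3) := by
  obtain ⟨hA, hdeg⟩ := hQ
  cases hA with
  | firstZagreb => exact value_overVertices_pow_le le_rfl hG
  | forgotten => simp [forgotten, DegreeLE] at hdeg
  | secondZagreb => exact value_overEdges_le 1 1 0 1 0 0 (fun a b => by simp; ring) hG
  | reducedSecondZagreb => exact value_overEdges_le 0 0 0 1 0 0 (fun a b => by simp) hG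
  | firstHyperZagreb => exact value_overEdges_le 4 4 1 2 0 0 (fun a b => by simp; ring) hG
  | secondHyperZagreb => exact value_overEdges_le 1 2 1 4 2 1 (fun a b => by simp; ring) hG
  | hyperF =>
    have h := hdeg 0
    rw [← MvPolynomial.natDegree_finSuccEquiv] at h
    have e : MvPolynomial.finSuccEquiv ℤ 1 (MvPolynomial.X 1) =
      Polynomial.C (MvPolynomial.X 0) := MvPolynomial.finSuccEquiv_X_succ (j := 0)
    simp only [map_pow, map_add, MvPolynomial.finSuccEquiv_X_zero, e] at h
    rw [← Polynomial.C_pow, Polynomial.natDegree_pow, Polynomial.natDegree_X_pow_add_C] at h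
    omega
  | firstReformulatedZagreb => exact value_overEdges_le 0 0 1 2 0 0 (fun a b => by simp; ring) hG
  | firstBanhatti => exact value_overEdges_le 2 3 0 0 0 0 (fun a b => by simp; ring) hG
  | secondBanhatti => exact value_overEdges_le 0 2 1 2 0 0 (fun a b => by simp; ring) hG
  | sumConnectivity r =>
    have h := hdeg 0
    rw [← MvPolynomial.natDegree_finSuccEquiv] at h
    have e : MvPolynomial.finSuccEquiv ℤ 1 (MvPolynomial.X 1) =
      Polynomial.C (MvPolynomial.X 0) := MvPolynomial.finSuccEquiv_X_succ (j := 0)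
    simp only [map_pow, map_add, MvPolynomial.finSuccEquiv_X_zero, e] at h
    rw [Polynomial.natDegree_pow, Polynomial.natDegree_X_add_C, mul_one] at h
    interval_cases r
    · exact value_overEdges_le 1 0 0 0 0 0 (fun a b => by simp) hG
    · exact value_overEdges_le 2 1 0 0 0 0 (fun a b => by simp; ring) hG
    · exact value_overEdges_le 4 4 1 2 0 0 (fun a b => by simp; ring) hG
  | zerothRandic r =>
    exact value_overVertices_pow_le (by simpa [zerothRandic, DegreeLE] using hdeg) hG
  | generalRandic r =>
    have h := hdeg 0
    rw [← MvPolynomial.natDegree_finSuccEquiv] at h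
    have e : MvPolynomial.finSuccEquiv ℤ 1 (MvPolynomial.X 1) =
      Polynomial.C (MvPolynomial.X 0) := MvPolynomial.finSuccEquiv_X_succ (j := 0)
    simp only [map_pow, map_mul, MvPolynomial.finSuccEquiv_X_zero, e] at h
    rw [Polynomial.natDegree_pow, Polynomial.natDegree_mul_C (MvPolynomial.X_ne_zero _),
      Polynomial.natDegree_X, mul_one] at h
    interval_cases r
    · exact value_overEdges_le 1 0 0 0 0 0 (fun a b => by simp) hG
    · exact value_overEdges_le 1 1 0 1 0 0 (fun a b => by simp; ring) hG
    · exact value_overEdges_le 1 2 1 4 2 1 (fun a b => by simp; ring) hG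
  | generalizedZagreb r s =>
    have key : r ≤ 2 ∧ s ≤ 2 := by
      have h := hdeg 0
      rw [← MvPolynomial.natDegree_finSuccEquiv] at h
      have e : MvPolynomial.finSuccEquiv ℤ 1 (MvPolynomial.X 1) =
        Polynomial.C (MvPolynomial.X 0) := MvPolynomial.finSuccEquiv_X_succ (j := 0)
      simp only [map_pow, map_mul, map_add, MvPolynomial.finSuccEquiv_X_zero, e] at h
      have hne : ∀ m : ℕ, (MvPolynomial.X 0 : MvPolynomial (Fin 1) ℤ) ^ m ≠ 0 :=
        fun m => pow_ne_zero _ (MvPolynomial.X_ne_zero _)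
      by_contra hcon
      rw [not_and_or, not_le, not_le] at hcon
      rcases hcon with hr | hs
      -- As a polynomial in the first variable, the coefficient of order `r` is a power of the
      -- second variable, doubled if `r = s`; it cannot vanish.
      · have := Polynomial.coeff_eq_zero_of_natDegree_lt (h.trans_lt hr)
        simp only [← Polynomial.C_pow, Polynomial.coeff_add, Polynomial.coeff_mul_C,
          Polynomial.coeff_X_pow] at this
        by_cases hrs : r = s
        · subst hrs
          simp [← two_mul, hne] at this
        · simp [hrs, hne] at this
      · have := Polynomial.coeff_eq_zero_of_natDegree_lt (h.trans_lt hs)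
        simp only [← Polynomial.C_pow, Polynomial.coeff_add, Polynomial.coeff_mul_C,
          Polynomial.coeff_X_pow] at this
        by_cases hrs : s = r
        · subst hrs
          simp [← two_mul, hne] at this
        · simp [hrs, hne] at this
    obtain ⟨hr, hs⟩ := key
    interval_cases r <;> interval_cases s
    · exact value_overEdges_le 2 0 0 0 0 0 (fun a b => by simp; try ring) hG
    · exact value_overEdges_le 2 1 0 0 0 0 (fun a b => by simp; ring) hG
    · exact value_overEdges_le 2 2 1 0 0 0 (fun a b => by simp; ring) hG
    · exact value_overEdges_le 2 1 0 0 0 0 (fun a b => by simp; ring) hG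
    · exact value_overEdges_le 2 2 0 2 0 0 (fun a b => by simp; ring) hG
    · exact value_overEdges_le 2 3 1 4 1 0 (fun a b => by simp; ring) hG
    · exact value_overEdges_le 2 2 1 0 0 0 (fun a b => by simp; ring) hG
    · exact value_overEdges_le 2 3 1 4 1 0 (fun a b => by simp; ring) hG
    · exact value_overEdges_le 2 4 2 8 4 2 (fun a b => by simp; ring) hG

end Indices

/-! ### Double stars `S_{1,2}`. -/

section DoubleStar

lemma deg_add_deg_le {V : Type*} [Fintype V] (G : SimpleGraph V) (u v : V) :
    deg G u + deg G v ≤ Fintype.card V + codeg G u v := by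
  classical
  unfold deg codeg
  rw [← card_union_add_card_inter, ← filter_and]
  gcongr
  exact card_le_univ _

lemma codeg_lt_deg {V : Type*} [Fintype V] {G : SimpleGraph V} {u v : V} (h : G.Adj u v) :
    codeg G u v < deg G u := by
  classical
  refine card_lt_card ⟨fun a ha => ?_, fun hs => ?_⟩
  · simp only [mem_filter, mem_univ, true_and] at ha ⊢; exact ha.1
  · have := hs (by simpa using h : v ∈ _)
    simp at this

lemma codeg_comm {V : Type*} [Fintype V] (G : SimpleGraph V) (u v : V) :
    codeg G u v = codeg G v u := by
  classical
  unfold codeg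
  simp only [and_comm]

lemma codeg_turanGraph {n : ℕ} {u v : Fin n} (h : (SimpleGraph.turanGraph n 3).Adj u v) :
    deg (SimpleGraph.turanGraph n 3) u + deg (SimpleGraph.turanGraph n 3) v =
      n + codeg (SimpleGraph.turanGraph n 3) u v := by
  classical
  unfold deg codeg
  rw [← card_union_add_card_inter, ← filter_and]
  congr 1
  refine (congrArg card (eq_univ_iff_forall.2 fun a => ?_)).trans (card_fin n)
  simp only [SimpleGraph.turanGraph_adj, mem_union, mem_filter, mem_univ, true_and, ne_eq] at h ⊢
  by_contra hcon
  rw [not_or, not_not, not_not] at hcon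
  exact h (hcon.1.trans hcon.2.symm)

/-- The number of labelled double stars `S_{1,2}`. -/
noncomputable def starSum {V : Type*} [Fintype V] (G : SimpleGraph V) : ℤ :=
  arcSum G (fun u v => ((deg G v : ℤ) - 2) *
    (((deg G u : ℤ) - 1) * ((deg G v : ℤ) - 1) - 2 * codeg G u v))

/-- Adding the two orientations of each edge makes the summand symmetric. -/
lemma two_mul_starSum {V : Type*} [Fintype V] (G : SimpleGraph V) :
    2 * starSum G = arcSum G (fun u v => ((deg G u : ℤ) + deg G v - 4) *
      (((deg G u : ℤ) - 1) * ((deg G v : ℤ) - 1) - 2 * codeg G u v)) := by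
  rw [two_mul]
  nth_rw 2 [starSum]
  rw [← arcSum_swap, starSum, ← arcSum_add]
  refine arcSum_congr fun u v _ => ?_
  rw [codeg_comm G v u]; ring

/-- An upper bound for the contribution of an edge with ends of degree `x`, `y`. -/
def starBound (n x y : ℕ) : ℤ :=
  (((x - 3 : ℕ) : ℤ) + ((y - 3 : ℕ) : ℤ) + 2) *
    (((x - 3 : ℕ) : ℤ) * ((y - 3 : ℕ) : ℤ) + 2 * n - 8)

lemma starBound_comm (n x y : ℕ) : starBound n x y = starBound n y x := by
  unfold starBound; ring

/-- For `x ≥ 3`, replace `t` by its lower bound `x + y - n`: with `a = x - 3`, `b = y - 3` the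
second factor becomes `ab + 2n - 8`, so the shift by 3 removes its linear terms. For `x ≤ 2`
truncation intervenes, and `t < x` leaves few cases. -/
lemma le_starBound_of_le {n x y t : ℕ} (hn : 5 ≤ n) (hx : 1 ≤ x) (hxy : x ≤ y) (hyn : y < n)
    (ht : x + y ≤ n + t) (htx : t < x) :
    ((x : ℤ) + y - 4) * (((x : ℤ) - 1) * ((y : ℤ) - 1) - 2 * t) ≤ starBound n x y := by
  have ht' : (x : ℤ) + y ≤ n + t := by exact_mod_cast ht
  have hyn' : (y : ℤ) + 1 ≤ n := by exact_mod_cast hyn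
  have hn' : (5 : ℤ) ≤ n := by exact_mod_cast hn
  have hy0 : (0 : ℤ) ≤ ((y - 3 : ℕ) : ℤ) := by positivity
  have ht0 : (0 : ℤ) ≤ t := by positivity
  by_cases h3 : 3 ≤ x
  · have e1 : ((x - 3 : ℕ) : ℤ) = x - 3 := by omega
    have e2 : ((y - 3 : ℕ) : ℤ) = y - 3 := by omega
    have hx' : (3 : ℤ) ≤ x := by exact_mod_cast h3
    have hy' : (3 : ℤ) ≤ y := by exact_mod_cast h3.trans hxy
    unfold starBound
    rw [e1, e2]
    nlinarith
  · have h12 : x = 1 ∨ x = 2 := by omega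
    unfold starBound
    rcases h12 with rfl | rfl
    · have : t = 0 := by omega
      subst this
      have : (0 : ℤ) ≤ 2 * n - 8 := by linarith
      simp only [Nat.reduceLeDiff, Nat.sub_eq_zero_of_le]
      push_cast
      nlinarith
    · by_cases hy2 : y = 2
      · subst hy2
        simp only [Nat.reduceLeDiff, Nat.sub_eq_zero_of_le]
        push_cast
        nlinarith
      · have e2 : ((y - 3 : ℕ) : ℤ) = y - 3 := by omega
        have hy' : (3 : ℤ) ≤ y := by omega
        rw [e2]
        simp only [Nat.reduceLeDiff, Nat.sub_eq_zero_of_le]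
        push_cast
        by_cases h5 : n = 5
        · subst h5
          have : y = 3 ∨ y = 4 := by omega
          rcases this with rfl | rfl <;> push_cast at * <;> nlinarith
        · have : (6 : ℤ) ≤ n := by omega
          nlinarith

lemma arc_le_starBound {n : ℕ} (hn : 5 ≤ n) {G : SimpleGraph (Fin n)} {u v : Fin n}
    (h : G.Adj u v) : ((deg G u : ℤ) + deg G v - 4) *
      (((deg G u : ℤ) - 1) * ((deg G v : ℤ) - 1) - 2 * codeg G u v) ≤
      starBound n (deg G u) (deg G v) := by
  have h1 := deg_pos_of_adj h
  have h2 := deg_pos_of_adj h.symm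
  have h3 := deg_lt_card G u
  have h4 := deg_lt_card G v
  have h5 := deg_add_deg_le G u v
  have h6 := codeg_lt_deg h
  have h7 := codeg_lt_deg h.symm
  rw [codeg_comm G v u] at h7
  rw [Fintype.card_fin] at h3 h4 h5
  rcases le_total (deg G u) (deg G v) with hle | hle
  · exact le_starBound_of_le hn h1 hle h4 h5 h6
  · have := le_starBound_of_le hn h2 hle h3 (by omega) h7
    rw [starBound_comm]
    refine le_trans (le_of_eq ?_) this
    ring

/-- Twice the number of labelled double stars `S_{1,2}` in the Turán graph. -/
def turanStar (n : ℕ) : ℤ :=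
  2 * (((n + 2) / 3 : ℕ) * ((n + 1) / 3 : ℕ) * starBound n (n - (n + 2) / 3) (n - (n + 1) / 3) +
    ((n + 2) / 3 : ℕ) * (n / 3 : ℕ) * starBound n (n - (n + 2) / 3) (n - n / 3) +
    ((n + 1) / 3 : ℕ) * (n / 3 : ℕ) * starBound n (n - (n + 1) / 3) (n - n / 3))

lemma two_mul_starSum_turanGraph {n : ℕ} (hn : 5 ≤ n) :
    2 * starSum (SimpleGraph.turanGraph n 3) = turanStar n := by
  have h : 2 * starSum (SimpleGraph.turanGraph n 3) = arcSum (SimpleGraph.turanGraph n 3)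
      (fun u v => starBound n (deg (SimpleGraph.turanGraph n 3) u)
        (deg (SimpleGraph.turanGraph n 3) v)) := by
    rw [two_mul_starSum]
    refine arcSum_congr fun u v huv => ?_
    have h1 := codeg_turanGraph huv
    have h3 : ∀ w : Fin n, 3 ≤ deg (SimpleGraph.turanGraph n 3) w := fun w => by
      rw [deg_turanGraph, turanDeg]
      split_ifs <;> omega
    have hu := h3 u
    have hv := h3 v
    have e1 : ((deg (SimpleGraph.turanGraph n 3) u - 3 : ℕ) : ℤ) =
      deg (SimpleGraph.turanGraph n 3) u - 3 := by omega
    have e2 : ((deg (SimpleGraph.turanGraph n 3) v - 3 : ℕ) : ℤ) =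
      deg (SimpleGraph.turanGraph n 3) v - 3 := by omega
    have e3 : (codeg (SimpleGraph.turanGraph n 3) u v : ℤ) =
      deg (SimpleGraph.turanGraph n 3) u + deg (SimpleGraph.turanGraph n 3) v - n := by omega
    unfold starBound
    rw [e1, e2, e3]
    ring
  rw [h, arcSum_turanGraph_deg n (starBound n), turanStar,
    starBound_comm n (n - (n + 1) / 3) (n - (n + 2) / 3),
    starBound_comm n (n - n / 3) (n - (n + 2) / 3), starBound_comm n (n - n / 3) (n - (n + 1) / 3)]
  ring

lemma arcSum_starBound {n : ℕ} (G : SimpleGraph (Fin n)) :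
    arcSum G (fun u v => starBound n (deg G u) (deg G v)) =
      2 * mono 3 2 1 G + 2 * mono 3 1 1 G + 2 * ((2 * n - 8) * mono 3 1 0 G) +
        (4 * n - 16) * mono 3 0 0 G := by
  have e1 : 2 * mono 3 2 1 G = mono 3 2 1 G + mono 3 1 2 G := by rw [mono_comm 3 1 2]; ring
  have e2 : 2 * ((2 * n - 8) * mono 3 1 0 G) =
    (2 * n - 8) * mono 3 1 0 G + (2 * n - 8) * mono 3 0 1 G := by rw [mono_comm 3 0 1]; ring
  rw [e1, e2]
  unfold mono
  simp only [← arcSum_add, ← arcSum_mul]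
  refine arcSum_congr fun u v _ => ?_
  unfold starBound sdeg
  ring

/-- The upper bound for `24 * m` times the number of labelled double stars, given bounds for the sums of
the degrees and of the powers of the shifted degrees. -/
def starUpper (n m q₀ q₁ q₂ q₃ : ℤ) : ℤ :=
  16 * q₂ ^ 2 + 3 * m ^ 2 * (q₃ + 3 * q₂) + (2 * m ^ 2 + 16 * m) * q₁ ^ 2 +
    24 * m * (2 * n - 8) * (q₂ + 3 * q₁) + 12 * m * (4 * n - 16) * q₀

/-- The factor `12 * m` clears denominators: 3 from Motzkin–Straus and `8 * m` from
`mono_two_one_le`. -/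
lemma starSum_le_of_bounds {n : ℕ} (hn : 5 ≤ n) {G : SimpleGraph (Fin n)} (hG : G.CliqueFree 4)
    {m q₀ q₁ q₂ q₃ : ℤ} (hm : 0 ≤ m) (h0 : ∑ v, (deg G v : ℤ) ≤ q₀)
    (h1 : ∑ v, shiftPow 3 1 (deg G v) ≤ q₁) (h2 : ∑ v, shiftPow 3 2 (deg G v) ≤ q₂)
    (h3 : ∑ v, shiftPow 3 3 (deg G v) ≤ q₃) :
    12 * m * (2 * starSum G) ≤ starUpper n m q₀ q₁ q₂ q₃ := by
  have hn' : (5 : ℤ) ≤ n := by exact_mod_cast hn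
  have hs : 2 * starSum G ≤ 2 * mono 3 2 1 G + 2 * mono 3 1 1 G + 2 * ((2 * n - 8) * mono 3 1 0 G) +
      (4 * n - 16) * mono 3 0 0 G := by
    rw [← arcSum_starBound, two_mul_starSum]
    exact arcSum_le_arcSum fun u v huv => arc_le_starBound hn huv
  have h21 := mono_two_one_le 3 m G
  have h11 := three_mul_mono_le 3 1 hG
  have h22 := three_mul_mono_le 3 2 hG
  have e20 := mono_zero_right 3 1 G
  have e10 := mono_zero_right 3 0 G
  have e00 : mono 3 0 0 G = ∑ v, (deg G v : ℤ) := by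
    unfold mono
    simp only [pow_zero, mul_one]
    rw [arcSum_left]; simp only [mul_one]
  have p1 : 0 ≤ ∑ v, shiftPow 3 1 (deg G v) := sum_nonneg fun v _ => shiftPow_nonneg _ _ _
  have p2 : 0 ≤ ∑ v, shiftPow 3 2 (deg G v) := sum_nonneg fun v _ => shiftPow_nonneg _ _ _
  simp only [Nat.reduceAdd, zero_add] at e20 e10
  rw [e00, e10] at hs
  rw [e20] at h21
  have b1 := pow_le_pow_left₀ p1 h1 2
  have b2 := pow_le_pow_left₀ p2 h2 2
  generalize ∑ v, shiftPow 3 1 (deg G v) = Q1 at *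
  generalize ∑ v, shiftPow 3 2 (deg G v) = Q2 at *
  generalize ∑ v, shiftPow 3 3 (deg G v) = Q3 at *
  generalize ∑ v, (deg G v : ℤ) = Q0 at *
  have hm2 := sq_nonneg m
  have c1 := mul_le_mul_of_nonneg_left hs (show 0 ≤ 12 * m by linarith)
  have c2 := mul_le_mul_of_nonneg_left h11 hm2
  have c3 := mul_le_mul_of_nonneg_left h11 hm
  have c4 := mul_le_mul_of_nonneg_left b1 hm2
  have c5 := mul_le_mul_of_nonneg_left b1 hm
  have c6 := mul_le_mul_of_nonneg_left h2 hm2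
  have c7 := mul_le_mul_of_nonneg_left h3 hm2
  have c8 := mul_le_mul_of_nonneg_left h2 (mul_nonneg hm (show (0 : ℤ) ≤ 2 * n - 8 by linarith))
  have c9 := mul_le_mul_of_nonneg_left h1 (mul_nonneg hm (show (0 : ℤ) ≤ 2 * n - 8 by linarith))
  have c10 := mul_le_mul_of_nonneg_left h0 (mul_nonneg hm (show (0 : ℤ) ≤ 4 * n - 16 by linarith))
  unfold starUpper
  push_cast at *
  linarith

/-- The coefficient used to bound the mixed terms. -/
def starCoeff (n : ℕ) : ℤ := 4 * (n / 3 : ℕ) - 6 + (n % 3 : ℕ)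

lemma starSum_le_of_large {n : ℕ} (hn : 12 ≤ n) {G : SimpleGraph (Fin n)} (hG : G.CliqueFree 4)
    (hne : ¬ Nonempty (G ≃g SimpleGraph.turanGraph n 3)) :
    starSum G ≤ starSum (SimpleGraph.turanGraph n 3) := by
  have hc : GoodShift 3 n := ⟨by omega, by omega⟩
  have s0 := sum_shiftPow_le (c := 0) ⟨by omega, by omega⟩ hG (j := 1) (by simp)
  have s1 := sum_shiftPow_lt hc hG hne (j := 1) (by simp)
  have s2 := sum_shiftPow_le hc hG (j := 2) (by simp)
  have s3 := sum_shiftPow_le hc hG (j := 3) (by simp)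
  have hm : 0 < starCoeff n := by unfold starCoeff; omega
  have h := starSum_le_of_bounds (by omega) hG hm.le (by simpa [shiftPow] using s0)
    (Int.le_sub_one_of_lt s1) s2 s3
  have hT := two_mul_starSum_turanGraph (n := n) (by omega)
  suffices hh : starUpper n (starCoeff n) (triVal n (shiftPow 0 1) (n / 3) ((n + 1) / 3) ((n + 2) / 3))
      (triVal n (shiftPow 3 1) (n / 3) ((n + 1) / 3) ((n + 2) / 3) - 1)
      (triVal n (shiftPow 3 2) (n / 3) ((n + 1) / 3) ((n + 2) / 3))
      (triVal n (shiftPow 3 3) (n / 3) ((n + 1) / 3) ((n + 2) / 3)) ≤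
      12 * starCoeff n * turanStar n by
    rw [← hT] at hh
    have := le_of_mul_le_mul_left (h.trans hh) (by linarith)
    linarith
  obtain ⟨k, hk⟩ := turan_parts (n := n) (c := 3) (by omega)
  obtain ⟨k', hk'⟩ := turan_parts (n := n) (c := 0) (by omega)
  have hkk : k' = k := by omega
  subst hkk
  have hk1 : 4 ≤ k' := by omega
  obtain ⟨l, rfl⟩ := Nat.exists_eq_add_of_le hk1
  have hl := fun i => pow_nonneg (Nat.cast_nonneg (α := ℤ) l) i
  unfold starUpper turanStar starBound triVal shiftPow
  rcases hk with ⟨a1, a2, a3, b1, b2, b3, e⟩ | ⟨a1, a2, a3, b1, b2, b3, e⟩ |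
    ⟨a1, a2, a3, b1, b2, b3, e⟩ <;>
  rcases hk' with ⟨-, -, -, d1, d2, d3, e'⟩ | ⟨-, -, -, d1, d2, d3, e'⟩ |
    ⟨-, -, -, d1, d2, d3, e'⟩ <;> try omega
  · have hmm : starCoeff n = 4 * l + 10 := by unfold starCoeff; omega
    have en : (n : ℤ) = 3 * (4 + l) := by exact_mod_cast e
    rw [a1, a2, a3, b1, b2, b3, d1, d2, d3, hmm, en]
    push_cast
    linarith [hl 1, hl 2, hl 3, hl 4, hl 5, hl 6]
  · have hmm : starCoeff n = 4 * l + 11 := by unfold starCoeff; omega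
    have en : (n : ℤ) = 3 * (4 + l) + 1 := by exact_mod_cast e
    rw [a1, a2, a3, b1, b2, b3, d1, d2, d3, hmm, en]
    push_cast
    linarith [hl 1, hl 2, hl 3, hl 4, hl 5, hl 6]
  · have hmm : starCoeff n = 4 * l + 12 := by unfold starCoeff; omega
    have en : (n : ℤ) = 3 * (4 + l) + 2 := by exact_mod_cast e
    rw [a1, a2, a3, b1, b2, b3, d1, d2, d3, hmm, en]
    push_cast
    linarith [hl 1, hl 2, hl 3, hl 4, hl 5, hl 6]

instance (n a b c : ℕ) : Decidable (Balanced n a b c) := by unfold Balanced; infer_instance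

/-- Smoothing with shift 3 is only available from `n = 12` on, so here all majorizing triples are
checked. Only a balanced triple gets the deficit of one. -/
lemma starUpper_le_of_small : ∀ n : ℕ, n < 12 → 6 ≤ n → ∀ a : ℕ, a < 12 → ∀ b : ℕ, b < 12 → a + b ≤ n →
    starUpper n (starCoeff n) (triVal n (shiftPow 0 1) a b (n - a - b))
      (triVal n (shiftPow 3 1) a b (n - a - b) - if Balanced n a b (n - a - b) then 1 else 0)
      (triVal n (shiftPow 3 2) a b (n - a - b)) (triVal n (shiftPow 3 3) a b (n - a - b)) ≤
      12 * starCoeff n * turanStar n := by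
  decide +kernel

lemma starSum_le_of_medium {n : ℕ} (hn : 6 ≤ n) (hn' : n < 12) {G : SimpleGraph (Fin n)}
    (hG : G.CliqueFree 4) (hne : ¬ Nonempty (G ≃g SimpleGraph.turanGraph n 3)) :
    starSum G ≤ starSum (SimpleGraph.turanGraph n 3) := by
  obtain ⟨a, b, c, hs, h, h'⟩ := exists_triVal hG
  have hm : 0 < starCoeff n := by unfold starCoeff; omega
  have h1 : ∑ v, shiftPow 3 1 (deg G v) ≤
      triVal n (shiftPow 3 1) a b c - if Balanced n a b c then 1 else 0 := by
    split_ifs with hb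
    · refine Int.le_sub_one_of_lt (h' hb hne _ (shiftPow_mono 3 1) fun d e hde he =>
        shiftPow_lt (by omega) hde ?_)
      omega
    · simpa using h _ (shiftPow_mono 3 1)
  have hu := starSum_le_of_bounds (by omega) hG hm.le
    (by simpa [shiftPow] using h _ (shiftPow_mono 0 1)) h1 (h _ (shiftPow_mono 3 2))
    (h _ (shiftPow_mono 3 3))
  have hd := starUpper_le_of_small n hn' hn a (by omega) b (by omega) (by omega)
  have hc : n - a - b = c := by omega
  rw [hc, ← two_mul_starSum_turanGraph (by omega)] at hd
  have := le_of_mul_le_mul_left (hu.trans hd) (by linarith)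
  linarith

/-- The edge contribution is bounded by a one-vertex part `w` plus 4 for each pair of adjacent
vertices of degree 4; this is tight on the edges of `T(5,3)`. The function `φ` is the degree times
`w`, since a vertex term is counted once per neighbour. -/
lemma starSum_le_five {G : SimpleGraph (Fin 5)} (hG : G.CliqueFree 4) :
    starSum G ≤ starSum (SimpleGraph.turanGraph 5 3) := by
  set w : ℕ → ℤ := fun d => if 4 ≤ d then 4 else if d = 3 then 2 else 0 with hw
  set ψ : ℕ → ℤ := fun d => if 4 ≤ d then 1 else 0 with hψ
  set φ : ℕ → ℤ := fun d => if 4 ≤ d then 16 else if d = 3 then 6 else 0 with hφ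
  have hT := two_mul_starSum_turanGraph (n := 5) le_rfl
  have hT' : turanStar 5 = 80 := by decide +kernel
  have hle : 2 * starSum G ≤ arcSum G (fun u v => (w (deg G u) + w (deg G v)) +
      4 * (ψ (deg G u) * ψ (deg G v))) := by
    rw [two_mul_starSum]
    refine arcSum_le_arcSum fun u v huv => ?_
    have h1 := deg_pos_of_adj huv
    have h2 := deg_pos_of_adj huv.symm
    have h3 := deg_lt_card G u
    have h4 := deg_lt_card G v
    have h5 := deg_add_deg_le G u v
    have h6 := codeg_lt_deg huv
    have h7 := codeg_lt_deg huv.symm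
    rw [codeg_comm G v u] at h7
    rw [Fintype.card_fin] at h3 h4 h5
    simp only [hw, hψ]
    generalize deg G u = x at *
    generalize deg G v = y at *
    generalize codeg G u v = t at *
    interval_cases x <;> interval_cases y <;> norm_num <;> omega
  have e1 : arcSum G (fun u v => w (deg G u) + w (deg G v)) = 2 * ∑ v, φ (deg G v) := by
    rw [arcSum_add_swap G (fun v => w (deg G v))]
    congr 1
    refine sum_congr rfl fun v _ => ?_
    have := deg_lt_card G v
    rw [Fintype.card_fin] at this
    simp only [hw, hφ]
    generalize deg G v = x at *
    interval_cases x <;> simp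
  rw [arcSum_add, arcSum_mul, e1] at hle
  have hms := three_mul_arcSum_le hG (w := fun v => ψ (deg G v))
    (fun v => by simp only [hψ]; split_ifs <;> norm_num)
  have hψm : Monotone ψ := fun a b hab => by simp only [hψ]; split_ifs <;> omega
  have hφm : Monotone φ := fun a b hab => by simp only [hφ]; split_ifs <;> omega
  have hψ0 : 0 ≤ ∑ v, ψ (deg G v) := sum_nonneg fun v _ => by
    simp only [hψ]; split_ifs <;> norm_num
  obtain ⟨a, b, c, hs, h, -⟩ := exists_triVal hG
  have hψs := pow_le_pow_left₀ hψ0 (h ψ hψm) 2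
  have hφs := h φ hφm
  -- The integer division matters: for parts 1, 2, 2 the Motzkin–Straus bound `2 / 3` rounds down to
  -- 0 and the total is exactly 80.
  have key : ∀ a : ℕ, a < 6 → ∀ b : ℕ, b < 6 → a + b ≤ 5 → 2 * triVal 5 φ a b (5 - a - b) +
      4 * (2 * (triVal 5 ψ a b (5 - a - b)) ^ 2 / 3) ≤ 80 := by
    simp only [hφ, hψ]
    decide +kernel
  have := key a (by omega) b (by omega) (by omega)
  have hc : 5 - a - b = c := by omega
  rw [hc] at this
  omega

/-- The Turán graph maximises the number of labelled double stars `S_{1,2}`. -/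
theorem starSum_le {n : ℕ} (hn : 5 ≤ n) {G : SimpleGraph (Fin n)} (hG : G.CliqueFree 4)
    (hne : ¬ Nonempty (G ≃g SimpleGraph.turanGraph n 3)) :
    starSum G ≤ starSum (SimpleGraph.turanGraph n 3) := by
  by_cases h5 : n = 5
  · subst h5; exact starSum_le_five hG
  by_cases h12 : n < 12
  · exact starSum_le_of_medium (by omega) h12 hG hne
  · exact starSum_le_of_large (by omega) hG hne

end DoubleStar

/-! ### Books `B_1(1,1)`. -/

section Book

variable {V : Type*} [Fintype V]

lemma triSum_le_triSum {G : SimpleGraph V} {f g : V → V → V → ℤ}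
    (h : ∀ u v x, G.Adj u v → G.Adj u x → G.Adj v x → f u v x ≤ g u v x) :
    triSum G f ≤ triSum G g := by
  classical
  refine sum_le_sum fun u _ => sum_le_sum fun v _ => sum_le_sum fun x _ => ?_
  split_ifs with hh
  exacts [h u v x hh.1 hh.2.1 hh.2.2, le_rfl]

lemma triSum_add (G : SimpleGraph V) (f g : V → V → V → ℤ) :
    triSum G (fun u v x => f u v x + g u v x) = triSum G f + triSum G g := by
  classical
  simp only [triSum, ← sum_add_distrib]
  refine sum_congr rfl fun u _ => sum_congr rfl fun v _ => sum_congr rfl fun x _ => ?_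
  split_ifs <;> simp

lemma triSum_const (G : SimpleGraph V) (a : ℤ) :
    triSum G (fun _ _ _ => a) = a * triSum G (fun _ _ _ => 1) := by
  classical
  simp only [triSum, mul_sum]
  refine sum_congr rfl fun u _ => sum_congr rfl fun v _ => sum_congr rfl fun x _ => ?_
  split_ifs <;> simp

lemma triSum_rotate (G : SimpleGraph V) (f : V → V → V → ℤ) :
    triSum G (fun u v x => f v x u) = triSum G f := by
  classical
  unfold triSum
  rw [sum_comm]
  refine sum_congr rfl fun v _ => ?_
  rw [sum_comm]
  refine sum_congr rfl fun x _ => sum_congr rfl fun u _ => ?_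
  refine if_congr ?_ rfl rfl
  rw [G.adj_comm u v, G.adj_comm u x]
  tauto

/-- Count by a vertex `a`: it is adjacent to at most two vertices of the triangle, and the number of
those exceeds the number of pairs of them by at most one. -/
lemma deg_add_deg_add_deg_le {G : SimpleGraph V} (hG : G.CliqueFree 4) {u v x : V}
    (huv : G.Adj u v) (hux : G.Adj u x) (hvx : G.Adj v x) :
    deg G u + deg G v + deg G x ≤ 2 * Fintype.card V ∧
    deg G u + deg G v + deg G x ≤ Fintype.card V + (codeg G u v + codeg G v x + codeg G x u) := by
  classical
  simp only [deg, codeg, card_filter]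
  rw [← card_univ, card_eq_sum_ones, mul_sum]
  simp only [← sum_add_distrib]
  have key : ∀ a, ¬ (G.Adj u a ∧ G.Adj v a ∧ G.Adj x a) := fun a ⟨h1, h2, h3⟩ =>
    not_four_adj hG huv hux h1 hvx h2 h3
  constructor <;> refine sum_le_sum fun a _ => ?_ <;> have := key a <;>
    by_cases h1 : G.Adj u a <;> by_cases h2 : G.Adj v a <;> by_cases h3 : G.Adj x a <;>
    simp_all

/-- The number of labelled copies of `B_1(1,1)`. -/
noncomputable def bookSum (G : SimpleGraph V) : ℤ :=
  triSum G (fun u v _ => ((deg G u : ℤ) - 2) * ((deg G v : ℤ) - 2) - ((codeg G u v : ℤ) - 1))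

lemma three_mul_bookSum (G : SimpleGraph V) : 3 * bookSum G = triSum G (fun u v x =>
    ((deg G u : ℤ) - 2) * ((deg G v : ℤ) - 2) + ((deg G v : ℤ) - 2) * ((deg G x : ℤ) - 2) +
      ((deg G x : ℤ) - 2) * ((deg G u : ℤ) - 2) -
      ((codeg G u v : ℤ) + codeg G v x + codeg G x u - 3)) := by
  set f : V → V → V → ℤ :=
    fun u v _ => ((deg G u : ℤ) - 2) * ((deg G v : ℤ) - 2) - ((codeg G u v : ℤ) - 1) with hf
  have h1 : bookSum G = triSum G f := rfl
  have h2 := triSum_rotate G f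
  have h3 := triSum_rotate G (fun u v x => f v x u)
  rw [h2] at h3
  calc 3 * bookSum G = triSum G f + triSum G (fun u v x => f v x u) +
        triSum G (fun u v x => f x u v) := by rw [h1, h2, h3]; ring
    _ = _ := by
      rw [← triSum_add, ← triSum_add]
      congr 1
      funext u v x
      simp only [hf]; ring

/-- The sum, over the three choices of the root edge in a triangle of the Turán graph, of the number
of ways to attach the leaves. -/
def bookBound (n : ℕ) : ℤ := (4 * ((n : ℤ) - 3) ^ 2 - 3 * ((n : ℤ) - 3)) / 3

lemma triSum_turanGraph (n : ℕ) : triSum (SimpleGraph.turanGraph n 3) (fun _ _ _ => 1) =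
    6 * ((n / 3) * ((n + 1) / 3) * ((n + 2) / 3) : ℕ) := by
  classical
  unfold triSum
  simp only [SimpleGraph.turanGraph_adj]
  have h1 : ∀ r s : ℕ, (∑ x : Fin n, if r ≠ s ∧ r ≠ (x : ℕ) % 3 ∧ s ≠ (x : ℕ) % 3
      then (1 : ℤ) else 0) = _ :=
    fun r s => sum_mod_three n (fun t => if r ≠ s ∧ r ≠ t ∧ s ≠ t then 1 else 0)
  simp only [h1]
  have h2 : ∀ r : ℕ, (∑ v : Fin n, (fun s : ℕ => (_ : ℤ)) ((v : ℕ) % 3)) = _ :=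
    fun r => sum_mod_three n (fun s => ((n + 2) / 3 : ℕ) * (if r ≠ s ∧ r ≠ 0 ∧ s ≠ 0 then 1 else 0) +
      ((n + 1) / 3 : ℕ) * (if r ≠ s ∧ r ≠ 1 ∧ s ≠ 1 then 1 else 0) +
      (n / 3 : ℕ) * (if r ≠ s ∧ r ≠ 2 ∧ s ≠ 2 then 1 else 0))
  simp only [h2]
  rw [sum_mod_three n (fun r => ((n + 2) / 3 : ℕ) * (((n + 2) / 3 : ℕ) * (if r ≠ 0 ∧ r ≠ 0 ∧ 0 ≠ 0 then 1 else 0) +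
      ((n + 1) / 3 : ℕ) * (if r ≠ 0 ∧ r ≠ 1 ∧ 0 ≠ 1 then 1 else 0) +
      (n / 3 : ℕ) * (if r ≠ 0 ∧ r ≠ 2 ∧ 0 ≠ 2 then 1 else 0)) +
    ((n + 1) / 3 : ℕ) * (((n + 2) / 3 : ℕ) * (if r ≠ 1 ∧ r ≠ 0 ∧ 1 ≠ 0 then 1 else 0) +
      ((n + 1) / 3 : ℕ) * (if r ≠ 1 ∧ r ≠ 1 ∧ 1 ≠ 1 then 1 else 0) +
      (n / 3 : ℕ) * (if r ≠ 1 ∧ r ≠ 2 ∧ 1 ≠ 2 then 1 else 0)) +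
    (n / 3 : ℕ) * (((n + 2) / 3 : ℕ) * (if r ≠ 2 ∧ r ≠ 0 ∧ 2 ≠ 0 then 1 else 0) +
      ((n + 1) / 3 : ℕ) * (if r ≠ 2 ∧ r ≠ 1 ∧ 2 ≠ 1 then 1 else 0) +
      (n / 3 : ℕ) * (if r ≠ 2 ∧ r ≠ 2 ∧ 2 ≠ 2 then 1 else 0)))]
  simp
  ring

lemma three_mul_bookSum_le {n : ℕ} (hn : 5 ≤ n) {G : SimpleGraph (Fin n)} (hG : G.CliqueFree 4) :
    3 * bookSum G ≤ bookBound n * triSum G (fun _ _ _ => 1) := by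
  rw [three_mul_bookSum, ← triSum_const]
  refine triSum_le_triSum fun u v x huv hux hvx => ?_
  obtain ⟨h1, h2⟩ := deg_add_deg_add_deg_le hG huv hux hvx
  rw [Fintype.card_fin] at h1 h2
  have hdeg : ∀ {a b c : Fin n}, G.Adj a b → G.Adj a c → G.Adj b c → 2 ≤ deg G a := by
    intro a b c hab hac hbc
    have := codeg_lt_deg hab
    have : 0 < codeg G a b := by
      classical
      exact card_pos.2 ⟨c, by simp [hac, hbc]⟩
    omega
  have d1 := hdeg huv hux hvx
  have d2 := hdeg huv.symm hvx hux
  have d3 := hdeg hux.symm hvx.symm huv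
  rw [bookBound, Int.le_ediv_iff_mul_le (by norm_num)]
  zify at h1 h2 d1 d2 d3 hn
  generalize (deg G u : ℤ) = a at *
  generalize (deg G v : ℤ) = b at *
  generalize (deg G x : ℤ) = c at *
  -- With `s = a + b + c - 6`, the left side is convex on `0 ≤ s ≤ 2(n - 3)` and, as `n ≥ 5`,
  -- largest at the right end. The final squares bound the sum of pairwise products by `s ^ 2 / 3`.
  have h3 : (a + b + c - 6) ^ 2 - 3 * (a + b + c - 6 - (n - 3)) ≤ 4 * ((n : ℤ) - 3) ^ 2 - 3 * (n - 3) := by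
    nlinarith
  nlinarith [sq_nonneg (a - b), sq_nonneg (b - c), sq_nonneg (a - c)]

/-- Degrees differing by at most one lose less than 1 to the real optimum, which is what the floor
in `bookBound` discards. -/
lemma bookBound_eq {n : ℕ} {a b c e : ℤ} (hs : a + b + c = 2 * n) (ha : a = e ∨ a = e + 1)
    (hb : b = e ∨ b = e + 1) (hc : c = e ∨ c = e + 1) :
    (a - 2) * (b - 2) + (b - 2) * (c - 2) + (c - 2) * (a - 2) -
      (a + b - n + (b + c - n) + (c + a - n) - 3) = bookBound n := by
  have hq : 4 * (n : ℤ) ^ 2 = (a + b + c) ^ 2 := by rw [hs]; ring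
  rw [bookBound]
  symm
  rw [Int.ediv_eq_iff_of_pos (by norm_num)]
  rcases ha with rfl | rfl <;> rcases hb with rfl | rfl <;> rcases hc with rfl | rfl <;>
    constructor <;> linarith

lemma three_mul_bookSum_turanGraph (n : ℕ) : 3 * bookSum (SimpleGraph.turanGraph n 3) =
    bookBound n * triSum (SimpleGraph.turanGraph n 3) (fun _ _ _ => 1) := by
  rw [three_mul_bookSum, ← triSum_const]
  refine le_antisymm (triSum_le_triSum fun u v x huv hux hvx => le_of_eq ?_)
    (triSum_le_triSum fun u v x huv hux hvx => le_of_eq (Eq.symm ?_)) <;>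
  · have e1 := codeg_turanGraph huv
    have e2 := codeg_turanGraph hvx
    have e3 := codeg_turanGraph hux.symm
    simp only [SimpleGraph.turanGraph_adj] at huv hux hvx
    have hs : turanDeg n (u % 3) + turanDeg n (v % 3) + turanDeg n (x % 3) = 2 * n := by
      have r1 : (u : ℕ) % 3 < 3 := Nat.mod_lt _ (by norm_num)
      have r2 : (v : ℕ) % 3 < 3 := Nat.mod_lt _ (by norm_num)
      have r3 : (x : ℕ) % 3 < 3 := Nat.mod_lt _ (by norm_num)
      generalize (u : ℕ) % 3 = r at *
      generalize (v : ℕ) % 3 = s at *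
      generalize (x : ℕ) % 3 = t at *
      unfold turanDeg
      interval_cases r <;> interval_cases s <;> interval_cases t <;> simp at * <;> omega
    have hd : ∀ r, turanDeg n r = n - (n + 2) / 3 ∨ turanDeg n r = n - (n + 2) / 3 + 1 := by
      intro r; unfold turanDeg; split_ifs <;> omega
    rw [deg_turanGraph, deg_turanGraph] at e1 e2 e3
    rw [deg_turanGraph, deg_turanGraph, deg_turanGraph]
    zify at e1 e2 e3 hs
    have c1 := eq_sub_of_add_eq' e1.symm
    have c2 := eq_sub_of_add_eq' e2.symm
    have c3 := eq_sub_of_add_eq' e3.symm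
    have hd' : ∀ r, (turanDeg n r : ℤ) = (n - (n + 2) / 3 : ℕ) ∨
        (turanDeg n r : ℤ) = (n - (n + 2) / 3 : ℕ) + 1 := fun r => by exact_mod_cast hd r
    rw [c1, c2, c3]
    exact bookBound_eq hs (hd' _) (hd' _) (hd' _)

/-- The Turán graph maximises the number of labelled copies of `B_1(1,1)`. -/
theorem bookSum_le {n : ℕ} (hn : 5 ≤ n) {G : SimpleGraph (Fin n)} (hG : G.CliqueFree 4) :
    bookSum G ≤ bookSum (SimpleGraph.turanGraph n 3) := by
  obtain ⟨a, b, c, hs, h⟩ := exists_triSum_le hG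
  rw [Fintype.card_fin] at hs
  have h1 := mul_mul_le_balanced a b c
  rw [hs] at h1
  have h2 : triSum G (fun _ _ _ => 1) ≤ triSum (SimpleGraph.turanGraph n 3) (fun _ _ _ => 1) := by
    rw [triSum_turanGraph]
    refine h.trans ?_
    exact_mod_cast Nat.mul_le_mul_left 6 h1
  have hB : 0 ≤ bookBound n := by
    unfold bookBound
    have : (5 : ℤ) ≤ n := by exact_mod_cast hn
    refine Int.ediv_nonneg ?_ (by norm_num)
    nlinarith
  have h3 := three_mul_bookSum_le hn hG
  have h4 := three_mul_bookSum_turanGraph n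
  have := mul_le_mul_of_nonneg_left h2 hB
  linarith

end Book

/-! ### From subgraphs to labelled copies: automorphisms act simply transitively on the labellings
of a subgraph. -/

section CopyCount

variable {V W : Type*} {G : SimpleGraph V} {H : SimpleGraph W}

open SimpleGraph in
lemma toSubgraph_comp_iso (f : Copy H G) (e : H ≃g H) :
    (f.comp e.toCopy).toSubgraph = f.toSubgraph := by
  ext a b
  · simp only [Copy.toSubgraph, Subgraph.map_verts, Subgraph.verts_top, Set.image_univ, Set.mem_range]
    constructor
    · rintro ⟨x, rfl⟩; exact ⟨e x, rfl⟩
    · rintro ⟨x, rfl⟩; exact ⟨e.symm x, by simp⟩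
  · simp only [Copy.toSubgraph, Subgraph.map_adj, Relation.Map, Subgraph.top_adj]
    constructor
    · rintro ⟨x, y, h, rfl, rfl⟩; exact ⟨e x, e y, e.map_adj_iff.2 h, rfl, rfl⟩
    · rintro ⟨x, y, h, rfl, rfl⟩
      exact ⟨e.symm x, e.symm y, e.symm.map_adj_iff.2 h, by simp, by simp⟩

open SimpleGraph in
lemma exists_iso_of_toSubgraph_eq {f g : Copy H G} (h : g.toSubgraph = f.toSubgraph) :
    ∃ e : H ≃g H, g = f.comp e.toCopy := by
  have key : ∀ S : G.Subgraph, g.toSubgraph = S → ∃ e : H ≃g S.coe, ∀ x, (e x : V) = g x := by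
    rintro S rfl
    exact ⟨g.isoToSubgraph, fun x => rfl⟩
  obtain ⟨e, he⟩ := key _ h
  refine ⟨e.trans f.isoToSubgraph.symm, ?_⟩
  ext x
  rw [← he x]
  have h2 : ∀ y, (f.isoToSubgraph y : V) = f y := fun y => rfl
  simp only [Copy.comp_apply]
  change _ = f (f.isoToSubgraph.symm (e x))
  rw [← h2]
  simp

open SimpleGraph in
/-- Every copy of `H` is the range of as many labelled copies as `H` has automorphisms. -/
theorem copyCount_mul_card_iso [Fintype V] [Finite W] :
    G.copyCount H * Nat.card (H ≃g H) = Nat.card (Copy H G) := by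
  classical
  have := Fintype.ofFinite W
  have : Finite (H ≃g H) := DFunLike.finite _
  have := Fintype.ofFinite (H ≃g H)
  rw [copyCount_eq_card_image_copyToSubgraph, Nat.card_eq_fintype_card, Nat.card_eq_fintype_card,
    ← card_univ (α := Copy H G), card_eq_sum_card_image Copy.toSubgraph univ, sum_const_nat]
  intro S hS
  obtain ⟨f, -, rfl⟩ := mem_image.1 hS
  rw [← card_univ]
  symm
  refine card_bij (fun e _ => f.comp e.toCopy) ?_ ?_ ?_
  · intro e _
    simpa using toSubgraph_comp_iso f e
  · intro e _ e' _ h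
    ext x
    have := DFunLike.congr_fun h x
    exact f.injective (by simpa using this)
  · intro g hg
    obtain ⟨e, rfl⟩ := exists_iso_of_toSubgraph_eq (mem_filter.1 hg).2
    exact ⟨e, mem_univ _, rfl⟩

open SimpleGraph in
lemma copyCount_le_copyCount [Fintype V] [Finite W] {G G' : SimpleGraph V}
    (h : Nat.card (Copy H G) ≤ Nat.card (Copy H G')) : G.copyCount H ≤ G'.copyCount H := by
  have : Finite (H ≃g H) := DFunLike.finite _
  have : 0 < Nat.card (H ≃g H) := Nat.card_pos
  rw [← copyCount_mul_card_iso, ← copyCount_mul_card_iso] at h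
  exact Nat.le_of_mul_le_mul_right h this

open SimpleGraph in
lemma card_copy_iso {G' : SimpleGraph V} (e : G ≃g G') :
    Nat.card (Copy H G) = Nat.card (Copy H G') :=
  Nat.card_congr
    { toFun := fun f => e.toCopy.comp f
      invFun := fun f => e.symm.toCopy.comp f
      left_inv := fun f => by ext x; simp
      right_inv := fun f => by ext x; simp }

end CopyCount

/-! ### Counting labelled double stars and books. -/

section Labelled

instance (t p q : ℕ) : Finite (BookVertex t p q) :=
  Finite.of_surjective (α := Bool ⊕ Fin t ⊕ Fin p ⊕ Fin q)
    (fun | .inl true => .u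
         | .inl false => .v
         | .inr (.inl i) => .page i
         | .inr (.inr (.inl i)) => .leafU i
         | .inr (.inr (.inr i)) => .leafV i)
    (by
      rintro (_ | _ | i | i | i)
      exacts [⟨.inl true, rfl⟩, ⟨.inl false, rfl⟩, ⟨.inr (.inl i), rfl⟩, ⟨.inr (.inr (.inl i)), rfl⟩,
        ⟨.inr (.inr (.inr i)), rfl⟩])

variable {V : Type*}

lemma bookGraph_adj {t p q : ℕ} {x y : BookVertex t p q} (h : BookEdge t p q x y) :
    (bookGraph t p q).Adj x y := by
  refine (SimpleGraph.fromRel_adj _ _ _).2 ⟨?_, Or.inl h⟩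
  rintro rfl
  cases h

/-- The tuples of vertices of `G` that are the images of the vertices of a labelled `S_{1,2}`. -/
def IsStar (G : SimpleGraph V) (s : V × V × V × V × V) : Prop :=
  G.Adj s.1 s.2.1 ∧ (G.Adj s.1 s.2.2.1 ∧ s.2.2.1 ≠ s.2.1) ∧
    (G.Adj s.2.1 s.2.2.2.1 ∧ s.2.2.2.1 ≠ s.1) ∧ (G.Adj s.2.1 s.2.2.2.2 ∧ s.2.2.2.2 ≠ s.1) ∧
    s.2.2.1 ≠ s.2.2.2.1 ∧ s.2.2.1 ≠ s.2.2.2.2 ∧ s.2.2.2.1 ≠ s.2.2.2.2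

/-- The tuples of vertices of `G` that are the images of the vertices of a labelled `B_1(1,1)`. -/
def IsBook (G : SimpleGraph V) (s : V × V × V × V × V) : Prop :=
  (G.Adj s.1 s.2.1 ∧ G.Adj s.1 s.2.2.1 ∧ G.Adj s.2.1 s.2.2.1) ∧
    (G.Adj s.1 s.2.2.2.1 ∧ s.2.2.2.1 ≠ s.2.1 ∧ s.2.2.2.1 ≠ s.2.2.1) ∧
    (G.Adj s.2.1 s.2.2.2.2 ∧ s.2.2.2.2 ≠ s.1 ∧ s.2.2.2.2 ≠ s.2.2.1) ∧ s.2.2.2.1 ≠ s.2.2.2.2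

open SimpleGraph in
lemma card_copy_doubleStar (G : SimpleGraph V) :
    Nat.card (Copy (doubleStar 1 2) G) = Nat.card {s : V × V × V × V × V // IsStar G s} := by
  refine Nat.card_congr
    { toFun := fun f => ⟨(f .u, f .v, f (.leafU 0), f (.leafV 0), f (.leafV 1)), ?_⟩
      invFun := fun s => ⟨⟨fun | .u => s.1.1
                               | .v => s.1.2.1
                               | .page i => i.elim0
                               | .leafU _ => s.1.2.2.1
                               | .leafV i => if i = 0 then s.1.2.2.2.1 else s.1.2.2.2.2, ?_⟩, ?_⟩
      left_inv := ?_
      right_inv := ?_ }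
  · have hf : ∀ {x y}, x ≠ y → f x ≠ f y := fun h h' => h (f.injective h')
    refine ⟨?_, ⟨?_, hf (by simp)⟩, ⟨?_, hf (by simp)⟩, ⟨?_, hf (by simp)⟩, hf (by simp),
      hf (by simp), hf (by simp)⟩
    · exact f.toHom.map_adj (bookGraph_adj .root)
    · exact f.toHom.map_adj (bookGraph_adj (.leafU 0))
    · exact f.toHom.map_adj (bookGraph_adj (.leafV 0))
    · exact f.toHom.map_adj (bookGraph_adj (.leafV 1))
  · obtain ⟨⟨u, v, a, b, c⟩, h1, h2, h3, h4, h5, h6, h7⟩ := s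
    intro x y hxy
    obtain ⟨-, h | h⟩ := (SimpleGraph.fromRel_adj _ _ _).1 hxy
    · cases h with
      | root => exact h1
      | pageU i => exact i.elim0
      | pageV i => exact i.elim0
      | leafU i => exact h2.1
      | leafV i => dsimp only; split_ifs; exacts [h3.1, h4.1]
    · cases h with
      | root => exact h1.symm
      | pageU i => exact i.elim0
      | pageV i => exact i.elim0
      | leafU i => exact h2.1.symm
      | leafV i => dsimp only; split_ifs; exacts [h3.1.symm, h4.1.symm]
  · obtain ⟨⟨u, v, a, b, c⟩, h1, h2, h3, h4, h5, h6, h7⟩ := s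
    have n : (u ≠ v ∧ u ≠ a ∧ v ≠ b ∧ v ≠ c ∧ a ≠ v) ∧ (b ≠ u ∧ c ≠ u ∧ a ≠ b ∧ a ≠ c ∧ b ≠ c) :=
      ⟨⟨h1.ne, h2.1.ne, h3.1.ne, h4.1.ne, h2.2⟩, h3.2, h4.2, h5, h6, h7⟩
    obtain ⟨⟨n1, n2, n3, n4, n5⟩, n6, n7, n8, n9, n10⟩ := n
    rintro (_ | _ | i | i | i) (_ | _ | j | j | j) hij <;> (try exact i.elim0) <;>
      (try exact j.elim0) <;> (try fin_cases i) <;> (try fin_cases j) <;> first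
      | rfl
      | exact absurd hij (by assumption)
      | exact absurd hij.symm (by assumption)
  · intro f
    ext x
    rcases x with _ | _ | i | i | i
    · rfl
    · rfl
    · exact i.elim0
    · fin_cases i; rfl
    · fin_cases i <;> rfl
  · intro s
    rfl

open SimpleGraph in
lemma card_copy_bookGraph (G : SimpleGraph V) :
    Nat.card (Copy (bookGraph 1 1 1) G) = Nat.card {s : V × V × V × V × V // IsBook G s} := by
  refine Nat.card_congr
    { toFun := fun f => ⟨(f .u, f .v, f (.page 0), f (.leafU 0), f (.leafV 0)), ?_⟩
      invFun := fun s => ⟨⟨fun | .u => s.1.1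
                               | .v => s.1.2.1
                               | .page _ => s.1.2.2.1
                               | .leafU _ => s.1.2.2.2.1
                               | .leafV _ => s.1.2.2.2.2, ?_⟩, ?_⟩
      left_inv := ?_
      right_inv := ?_ }
  · have hf : ∀ {x y}, x ≠ y → f x ≠ f y := fun h h' => h (f.injective h')
    refine ⟨⟨?_, ?_, ?_⟩, ⟨?_, hf (by simp), hf (by simp)⟩, ⟨?_, hf (by simp), hf (by simp)⟩,
      hf (by simp)⟩
    · exact f.toHom.map_adj (bookGraph_adj .root)
    · exact f.toHom.map_adj (bookGraph_adj (.pageU 0))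
    · exact f.toHom.map_adj (bookGraph_adj (.pageV 0))
    · exact f.toHom.map_adj (bookGraph_adj (.leafU 0))
    · exact f.toHom.map_adj (bookGraph_adj (.leafV 0))
  · obtain ⟨⟨u, v, x, a, b⟩, ⟨h1, h2, h3⟩, h4, h5, h6⟩ := s
    intro x y hxy
    obtain ⟨-, h | h⟩ := (SimpleGraph.fromRel_adj _ _ _).1 hxy
    · cases h with
      | root => exact h1
      | pageU i => exact h2
      | pageV i => exact h3
      | leafU i => exact h4.1
      | leafV i => exact h5.1
    · cases h with
      | root => exact h1.symm
      | pageU i => exact h2.symm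
      | pageV i => exact h3.symm
      | leafU i => exact h4.1.symm
      | leafV i => exact h5.1.symm
  · obtain ⟨⟨u, v, x, a, b⟩, ⟨h1, h2, h3⟩, h4, h5, h6⟩ := s
    have n : (u ≠ v ∧ u ≠ x ∧ v ≠ x ∧ u ≠ a ∧ v ≠ b) ∧ (a ≠ v ∧ a ≠ x ∧ b ≠ u ∧ b ≠ x ∧ a ≠ b) :=
      ⟨⟨h1.ne, h2.ne, h3.ne, h4.1.ne, h5.1.ne⟩, h4.2.1, h4.2.2, h5.2.1, h5.2.2, h6⟩
    obtain ⟨⟨n1, n2, n3, n4, n5⟩, n6, n7, n8, n9, n10⟩ := n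
    rintro (_ | _ | i | i | i) (_ | _ | j | j | j) hij <;> (try fin_cases i) <;>
      (try fin_cases j) <;> first
      | rfl
      | exact absurd hij (by assumption)
      | exact absurd hij.symm (by assumption)
  · intro f
    ext x
    rcases x with _ | _ | i | i | i
    · rfl
    · rfl
    · fin_cases i; rfl
    · fin_cases i; rfl
    · fin_cases i; rfl
  · intro s
    rfl

variable [Fintype V]

open Classical in
lemma card_tuples (P : V × V × V × V × V → Prop) : (Nat.card {s // P s} : ℤ) =
    ∑ u, ∑ v, ∑ a, ∑ b, ∑ c, if P (u, v, a, b, c) then 1 else 0 := by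
  rw [Nat.card_eq_fintype_card, Fintype.card_subtype, card_filter]
  push_cast
  simp only [Fintype.sum_prod_type]

-- Here `A` and `B` are the possible leaves at the two centres. There are `#A * #B * (#B - 1)`
-- choices with `b ≠ c`; those with `a = b` or `a = c` number `#(A ∩ B) * (#B - 1)` each.
open Classical in
lemma sum_triples {A B : Finset V} : (∑ a, ∑ b, ∑ c,
    if a ∈ A ∧ b ∈ B ∧ c ∈ B ∧ a ≠ b ∧ a ≠ c ∧ b ≠ c then (1 : ℤ) else 0) =
    ((#B : ℤ) - 1) * (#A * #B - 2 * #(A ∩ B)) := by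
  have h1 : ∀ a b, (∑ c, if a ∈ A ∧ b ∈ B ∧ c ∈ B ∧ a ≠ b ∧ a ≠ c ∧ b ≠ c then (1 : ℤ) else 0) =
      if a ∈ A ∧ b ∈ B ∧ a ≠ b then (#B : ℤ) - 1 - (if a ∈ B then 1 else 0) else 0 := by
    intro a b
    split_ifs with h ha
    · have : ∀ c, (if a ∈ A ∧ b ∈ B ∧ c ∈ B ∧ a ≠ b ∧ a ≠ c ∧ b ≠ c then (1 : ℤ) else 0) =
          if c ∈ (B.erase b).erase a then 1 else 0 := fun c => if_congr (by
            simp only [mem_erase]; tauto) rfl rfl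
      simp only [this, sum_boole, filter_mem_eq_inter, univ_inter]
      rw [cast_card_erase_of_mem (by simp [h.2.2, ha]), cast_card_erase_of_mem h.2.1]
    · have : ∀ c, (if a ∈ A ∧ b ∈ B ∧ c ∈ B ∧ a ≠ b ∧ a ≠ c ∧ b ≠ c then (1 : ℤ) else 0) =
          if c ∈ B.erase b then 1 else 0 := fun c => if_congr (by
            have : c ∈ B → a ≠ c := fun hc hac => ha (hac ▸ hc)
            simp only [mem_erase]; tauto) rfl rfl
      simp only [this, sum_boole, filter_mem_eq_inter, univ_inter]
      rw [cast_card_erase_of_mem h.2.1, sub_zero]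
    · exact sum_eq_zero fun c _ => if_neg (by tauto)
  have h2 : ∀ a, (∑ b, if a ∈ A ∧ b ∈ B ∧ a ≠ b then (#B : ℤ) - 1 - (if a ∈ B then 1 else 0) else 0) =
      (if a ∈ A then (#B : ℤ) * (#B - 1) else 0) - if a ∈ A ∩ B then 2 * ((#B : ℤ) - 1) else 0 := by
    intro a
    by_cases haA : a ∈ A
    · by_cases haB : a ∈ B
      · have : ∀ b, (if a ∈ A ∧ b ∈ B ∧ a ≠ b then (#B : ℤ) - 1 - (if a ∈ B then 1 else 0) else 0) =
            if b ∈ B.erase a then (#B : ℤ) - 2 else 0 := fun b => if_congr (by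
              simp only [mem_erase]; tauto) (by simp only [haB, if_true]; ring) rfl
        simp only [this, sum_ite_mem, univ_inter, sum_const, nsmul_eq_mul]
        rw [cast_card_erase_of_mem haB]
        simp only [haA, haB, mem_inter, and_self, if_true]; ring
      · have : ∀ b, (if a ∈ A ∧ b ∈ B ∧ a ≠ b then (#B : ℤ) - 1 - (if a ∈ B then 1 else 0) else 0) =
            if b ∈ B then (#B : ℤ) - 1 else 0 := fun b => if_congr (by
              have : b ∈ B → a ≠ b := fun hc hac => haB (hac ▸ hc)
              tauto) (by simp [haB]) rfl
        simp only [this, sum_ite_mem, univ_inter, sum_const, nsmul_eq_mul]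
        simp [haA, haB]
    · simp [haA]
  simp only [h1, h2, sum_sub_distrib, sum_ite_mem, univ_inter, sum_const, nsmul_eq_mul]
  ring

open Classical in
lemma sum_pairs {A B : Finset V} : (∑ a, ∑ b,
    if a ∈ A ∧ b ∈ B ∧ a ≠ b then (1 : ℤ) else 0) = (#A : ℤ) * #B - #(A ∩ B) := by
  have h1 : ∀ a, (∑ b, if a ∈ A ∧ b ∈ B ∧ a ≠ b then (1 : ℤ) else 0) =
      (if a ∈ A then (#B : ℤ) else 0) - if a ∈ A ∩ B then 1 else 0 := by
    intro a
    by_cases haA : a ∈ A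
    · by_cases haB : a ∈ B
      · have : ∀ b, (if a ∈ A ∧ b ∈ B ∧ a ≠ b then (1 : ℤ) else 0) =
            if b ∈ B.erase a then 1 else 0 := fun b => if_congr (by
              simp only [mem_erase]; tauto) rfl rfl
        simp only [this, sum_boole, filter_mem_eq_inter, univ_inter]
        rw [cast_card_erase_of_mem haB]
        simp [haA, haB]
      · have : ∀ b, (if a ∈ A ∧ b ∈ B ∧ a ≠ b then (1 : ℤ) else 0) =
            if b ∈ B then 1 else 0 := fun b => if_congr (by
              have : b ∈ B → a ≠ b := fun hc hac => haB (hac ▸ hc)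
              tauto) rfl rfl
        simp only [this, sum_boole, filter_mem_eq_inter, univ_inter]
        simp [haA, haB]
    · simp [haA]
  simp only [h1, sum_sub_distrib, sum_ite_mem, univ_inter, sum_const, nsmul_eq_mul]
  ring

theorem card_copy_doubleStar_eq (G : SimpleGraph V) :
    (Nat.card (SimpleGraph.Copy (doubleStar 1 2) G) : ℤ) = starSum G := by
  classical
  rw [card_copy_doubleStar, card_tuples, starSum, arcSum]
  refine sum_congr rfl fun u _ => sum_congr rfl fun v _ => ?_
  split_ifs with huv
  · have := sum_triples (A := ({a | G.Adj u a} : Finset V).erase v)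
      (B := ({a | G.Adj v a} : Finset V).erase u)
    have hi : ({a | G.Adj u a} : Finset V).erase v ∩ ({a | G.Adj v a} : Finset V).erase u =
        ({a | G.Adj u a ∧ G.Adj v a} : Finset V) := by
      ext a
      simp only [mem_inter, mem_erase, mem_filter, mem_univ, true_and]
      refine ⟨fun h => ⟨h.1.2, h.2.2⟩, fun h => ⟨⟨h.2.ne', h.1⟩, h.1.ne', h.2⟩⟩
    rw [hi, cast_card_erase_of_mem (by simpa using huv.symm),
      cast_card_erase_of_mem (by simpa using huv)] at this
    refine Eq.trans ?_ (this.trans ?_)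
    · refine sum_congr rfl fun a _ => sum_congr rfl fun b _ => sum_congr rfl fun c _ => ?_
      refine if_congr ?_ rfl rfl
      simp only [IsStar, mem_erase, mem_filter, mem_univ, true_and]
      tauto
    · unfold deg codeg
      ring
  · exact sum_eq_zero fun a _ => sum_eq_zero fun b _ => sum_eq_zero fun c _ =>
      if_neg fun h => huv h.1

theorem card_copy_bookGraph_eq (G : SimpleGraph V) :
    (Nat.card (SimpleGraph.Copy (bookGraph 1 1 1) G) : ℤ) = bookSum G := by
  classical
  rw [card_copy_bookGraph, card_tuples, bookSum, triSum]
  refine sum_congr rfl fun u _ => sum_congr rfl fun v _ => sum_congr rfl fun x _ => ?_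
  split_ifs with h
  · obtain ⟨huv, hux, hvx⟩ := h
    have := sum_pairs (A := (({a | G.Adj u a} : Finset V).erase v).erase x)
      (B := (({a | G.Adj v a} : Finset V).erase u).erase x)
    have hi : (({a | G.Adj u a} : Finset V).erase v).erase x ∩
        (({a | G.Adj v a} : Finset V).erase u).erase x =
        ({a | G.Adj u a ∧ G.Adj v a} : Finset V).erase x := by
      ext a
      simp only [mem_inter, mem_erase, mem_filter, mem_univ, true_and]
      refine ⟨fun h => ⟨h.1.1, h.1.2.2, h.2.2.2⟩,
        fun h => ⟨⟨h.1, h.2.2.ne', h.2.1⟩, h.1, h.2.1.ne', h.2.2⟩⟩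
    rw [hi, cast_card_erase_of_mem (by simpa using ⟨hvx.ne', hux⟩),
      cast_card_erase_of_mem (by simpa using huv), cast_card_erase_of_mem (by simpa using ⟨hux.ne', hvx⟩),
      cast_card_erase_of_mem (by simpa using huv.symm),
      cast_card_erase_of_mem (by simpa using ⟨hux, hvx⟩)] at this
    refine Eq.trans ?_ (this.trans ?_)
    · refine sum_congr rfl fun a _ => sum_congr rfl fun b _ => ?_
      refine if_congr ?_ rfl rfl
      simp only [IsBook, mem_erase, mem_filter, mem_univ, true_and]
      tauto
    · unfold deg codeg
      ring
  · exact sum_eq_zero fun a _ => sum_eq_zero fun b _ => if_neg fun h' => h h'.1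

lemma card_copy_eq_zero {t p q : ℕ} {n : ℕ} (hn : n ≤ 4) (G : SimpleGraph (Fin n))
    {e : Fin 5 → BookVertex t p q} (he : Function.Injective e) :
    Nat.card (SimpleGraph.Copy (bookGraph t p q) G) = 0 := by
  have : IsEmpty (SimpleGraph.Copy (bookGraph t p q) G) := ⟨fun f => by
    have := Fintype.card_le_of_injective _ (f.injective.comp he)
    simp at this
    omega⟩
  exact Nat.card_of_isEmpty

theorem copyCount_doubleStar_le {n : ℕ} {G : SimpleGraph (Fin n)} (hG : G.CliqueFree 4) :
    G.copyCount (doubleStar 1 2) ≤ (SimpleGraph.turanGraph n 3).copyCount (doubleStar 1 2) := by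
  refine copyCount_le_copyCount ?_
  by_cases hn : n ≤ 4
  · rw [card_copy_eq_zero hn G (e := ![.u, .v, .leafU 0, .leafV 0, .leafV 1])]
    · exact Nat.zero_le _
    · intro i j; fin_cases i <;> fin_cases j <;> simp
  by_cases hiso : Nonempty (G ≃g SimpleGraph.turanGraph n 3)
  · exact (card_copy_iso hiso.some).le
  · have := starSum_le (by omega) hG hiso
    rw [← card_copy_doubleStar_eq, ← card_copy_doubleStar_eq] at this
    exact_mod_cast this

theorem copyCount_bookGraph_le {n : ℕ} {G : SimpleGraph (Fin n)} (hG : G.CliqueFree 4) :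
    G.copyCount (bookGraph 1 1 1) ≤ (SimpleGraph.turanGraph n 3).copyCount (bookGraph 1 1 1) := by
  refine copyCount_le_copyCount ?_
  by_cases hn : n ≤ 4
  · rw [card_copy_eq_zero hn G (e := ![.u, .v, .page 0, .leafU 0, .leafV 0])]
    · exact Nat.zero_le _
    · intro i j; fin_cases i <;> fin_cases j <;> simp
  · have := bookSum_le (by omega) hG
    rw [← card_copy_bookGraph_eq, ← card_copy_bookGraph_eq] at this
    exact_mod_cast this

end Labelled

end TuranIndex

theorem mainTheorem9 (n : ℕ) :
    IsGreatest {m : ℕ | ∃ G : SimpleGraph (Fin n), G.CliqueFree 4 ∧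
        G.copyCount (bookGraph 1 1 1) = m}
      ((SimpleGraph.turanGraph n 3).copyCount (bookGraph 1 1 1)) ∧
    IsGreatest {m : ℕ | ∃ G : SimpleGraph (Fin n), G.CliqueFree 4 ∧
        G.copyCount (doubleStar 1 2) = m}
      ((SimpleGraph.turanGraph n 3).copyCount (doubleStar 1 2)) ∧
    ∀ Q : DegreeIndex, Q.A0' →
      IsGreatest {x : ℤ | ∃ G : SimpleGraph (Fin n), G.CliqueFree 4 ∧ Q.value G = x}
        (Q.value (SimpleGraph.turanGraph n 3)) := by
  have hT : (SimpleGraph.turanGraph n 3).CliqueFree 4 :=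
    SimpleGraph.turanGraph_cliqueFree (by norm_num)
  refine ⟨⟨⟨_, hT, rfl⟩, ?_⟩, ⟨⟨_, hT, rfl⟩, ?_⟩, fun Q hQ => ⟨⟨_, hT, rfl⟩, ?_⟩⟩
  · rintro _ ⟨G, hG, rfl⟩; exact TuranIndex.copyCount_bookGraph_le hG
  · rintro _ ⟨G, hG, rfl⟩; exact TuranIndex.copyCount_doubleStar_le hG
  · rintro _ ⟨G, hG, rfl⟩; exact TuranIndex.value_le_turanGraph hQ hG
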